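/- **Tiles, assemblies, cuts.** A glue is a pair (label, integer strength). A tile type is a non-rotatable unit square with a glue on each of its four sides. For a finite set $T$ of tile types, a $T$-assembly is a nonempty partial function $\alpha:\mathbb Z^2\dashrightarrow T$; $\alpha\sqsubseteq\beta$ means that $\beta$ extends $\alpha$. Two tiles at adjacent positions bind with strength $s$ if their abutting sides carry the same glue, of strength $s$, and with strength $0$ otherwise. A cut of $\alpha$ is a partition of its tiles into two nonempty parts (the sides of the cut); its strength is the sum of the binding strengths between the two parts. An assembly is $\tau$-stable if each of its cuts has strength at least $\tau$. **aTAM.** A TAS is a triple $\mathcal T=(T,\sigma,\tau)$ with $T$ a finite set of tile types with nonnegative strengths, $\sigma$ a finite $\tau$-stable seed assembly, and $\tau\in\mathbb N$ the temperature. A step adds one tile at an empty position, where it binds with total strength at least $\tau$. **rgTAM.** An rgTAS is a pair $\mathcal S=(S,\sigma_S)$ with $S$ a finite set of tile types with strengths in $\{-1,0,1\}$ and $\sigma_S$ a finite $1$-stable seed assembly. A step $\alpha\to_+\beta$ adds one tile at an empty position, where it binds with total strength at least $1$; a step $\alpha\to_-(\beta_1,\beta_2)$ replaces $\alpha$ by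 one of the two sides $\beta_1,\beta_2$ of a cut of $\alpha$ of strength $\le 0$. In both models $\alpha\to\beta$ means that $\beta$ is the last assembly of a finite, or the pointwise limit of an infinite, sequence of steps from $\alpha$; $\mathcal A[\cdot]$ is the set of assemblies $\beta$ with $\text{seed}\to\beta$ (the producible assemblies). **Simulation.** Let $m\ge 1$ and let $B^S_m$ be the set of $m$-blocks over $S$, i.e. partial functions $\{0,\dots,m-1\}^2\dashrightarrow S$ (possibly empty). A valid representation is a partial function $R:B_m^S\dashrightarrow T$ such that $b\sqsubseteq c$ and $b\in\operatorname{dom}R$ imply $R(c)=R(b)$. For an $S$-assembly $\alpha'$ let $R^*(\alpha')$ be the (possibly empty) partial function on $\mathbb Z^2$ whose value at $x$ is the value of $R$ at the $m\times m$ block of $\alpha'$ with lower left corner $mx$. An rgTAS $\mathcal S$ simulates a TAS $\mathcal T$ if for some $m\ge1$ and some valid $R$: 1. (Equivalent productions.) The nonempty $R^*(\alpha')$ with $\alpha'\in\mathcal A[\mathcal S]$ are exactly the elements of $\mathcal A[\mathcal T]$; and each $\alpha'\in\mathcal A[\mathcal S]$ maps cleanly: either for each nonempty block of $\alpha'$,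 with coordinates $x$, there is $u\in\mathbb Z^2$, $u_1^2+u_2^2\le 1$, with $x+u\in\operatorname{dom}R^*(\alpha')$, or $\alpha'$ has at most one nonempty block. 2. ($\mathcal T$ follows $\mathcal S$.) For $\alpha',\beta'\in\mathcal A[\mathcal S]$, $\alpha'\to_+\beta'$ implies $R^*(\alpha')\to R^*(\beta')$ in $\mathcal T$. And if $\alpha',\beta_1,\beta_2\in\mathcal A[\mathcal S]$, $R^*(\alpha')\in\mathcal A[\mathcal T]$ and $\alpha'\to_-(\beta_1,\beta_2)$, then for one order $(\beta,\delta)$ of $\beta_1,\beta_2$: $\sigma_S\sqsubseteq\beta$, $R^*(\beta)=R^*(\alpha')$, and $\delta$, as well as every $\delta'\in\mathcal A[\mathcal S]$ with $\delta\to\delta'$, is contained in a single $m$-block on which $R$ is undefined. 3. ($\mathcal S$ models $\mathcal T$.) For each $\alpha\in\mathcal A[\mathcal T]$ there is $\Pi\subseteq\mathcal A[\mathcal S]$, with $R^*(\alpha')=\alpha$ for all $\alpha'\in\Pi$, such that for each $\beta\in\mathcal A[\mathcal T]$ with $\alpha\to\beta$: for each $\alpha'\in\Pi$ there is $\beta'\in\mathcal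 A[\mathcal S]$ with $R^*(\beta')=\beta$ and $\alpha'\to\beta'$; and whenever $\alpha'',\beta'\in\mathcal A[\mathcal S]$, $\alpha''\to\beta'$, $R^*(\alpha'')=\alpha$, $R^*(\beta')=\beta$, there is $\alpha'\in\Pi$ with $\alpha'\to\alpha''$. **The finger and flagpole system** is the TAS at temperature $2$ with pairwise different glues $g_1,\dots,g_{16}$, where $g_{11},g_{14}$ have strength $1$ and all others strength $2$, the following 18 tile types (written as north, east, south, west glue; $-$ is a side with a null glue of strength $0$), and as seed assembly the seed tile alone at the origin: seed $(g_1,-,g_4,-)$; keystone $(g_{11},g_{15},g_{14},-)$; flagpole $(-,g_{16},-,g_{15})$; flag $(-,-,-,g_{16})$; top: $(g_2,-,g_1,-)$, $(g_3,-,g_2,-)$, $(-,g_7,g_3,-)$, arm $(-,g_7,-,g_7)$, finger $(-,-,g_9,g_7)$, $(g_9,-,g_{10},-)$, $(g_{10},-,g_{11},-)$; bottom: $(g_4,-,g_5,-)$, $(g_5,-,g_6,-)$, $(g_6,g_8,-,-)$, arm $(-,g_8,-,g_8)$, finger $(g_{12},-,-,g_8)$, $(g_{13},-,g_{12},-)$,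 $(g_{14},-,g_{13},-)$. (From the seed two arms grow east, independently and to arbitrary lengths, each ending in a finger that points to the other arm. The keystone can attach only between the tips of two fingers that meet, binding to both; then the flagpole and the flag attach.) **Theorem.** No rgTAS simulates the finger and flagpole system. In particular, there is a TAS $\mathcal T=(T,\sigma,2)$ at temperature $2$ that cannot be simulated by any rgTAS. -/

import Mathlib

open scoped ENNReal

/-! ### Tiles, assemblies, cuts -/

/-- The four unit vectors of `ℤ²`, as compass directions. -/
inductive Dir
  | N | E | S | W
  deriving DecidableEq

instance : Fintype Dir := ⟨{.N, .E, .S, .W}, fun d => by cases d <;> decide⟩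

/-- The unit vector of a direction. -/
def Dir.vec : Dir → ℤ × ℤ
  | .N => (0, 1)
  | .E => (1, 0)
  | .S => (0, -1)
  | .W => (-1, 0)

/-- The opposite direction. -/
def Dir.opp : Dir → Dir
  | .N => .S
  | .E => .W
  | .S => .N
  | .W => .E

/-- A glue: a label (natural numbers encode the strings) and an integer strength. -/
structure Glue where
  label : ℕ
  strength : ℤ
  deriving DecidableEq

/-- A tile type: a unit square, not rotatable, with a glue on each side. -/
structure TileType where
  north : Glue
  east : Glue
  south : Glue
  west : Glue
  deriving DecidableEq

/-- The glue of a tile type on a given side. -/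
def TileType.side (t : TileType) : Dir → Glue
  | .N => t.north
  | .E => t.east
  | .S => t.south
  | .W => t.west

/-- The strength with which a tile `s` binds to a tile `t` placed next to it in direction `d`:
the common strength if the two abutting glues agree in label and strength, and `0` otherwise. -/
def bondStrength (s t : TileType) (d : Dir) : ℤ :=
  if s.side d = t.side d.opp then (s.side d).strength else 0

/-- A `T`-assembly is a partial function `ℤ² ⇀ T`. (The nowhere defined one is included in the
type; seeds and results of assembly sequences are required to be nonempty.) -/
abbrev Assembly (T : Finset TileType) := ℤ × ℤ → Option T

namespace Assembly

variable {T : Finset TileType}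

/-- The domain of an assembly. -/
def dom (α : Assembly T) : Set (ℤ × ℤ) := {p | α p ≠ none}

/-- The nowhere defined assembly. -/
def empty : Assembly T := fun _ => none

/-- `α` is a subassembly of `β`. -/
def Sub (α β : Assembly T) : Prop := ∀ p t, α p = some t → β p = some t

/-- The strength of the bond between the positions `p` and `p + d` (`0` unless both are tiled). -/
def bond (α : Assembly T) (p : ℤ × ℤ) (d : Dir) : ℤ :=
  match α p, α (p + d.vec) with
  | some s, some t => bondStrength s t d
  | _, _ => 0

/-- The ordered lattice edges that leave the set `A`. -/
def Crossing (A : Set (ℤ × ℤ)) : Set ((ℤ × ℤ) × Dir) := {e | e.1 ∈ A ∧ e.1 + e.2.vec ∉ A}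

/-- Total positive strength of the bonds between `A` and its complement. -/
noncomputable def posStrength (α : Assembly T) (A : Set (ℤ × ℤ)) : ℝ≥0∞ :=
  ∑' e : Crossing A, ((α.bond e.1.1 e.1.2).toNat : ℝ≥0∞)

/-- Total absolute value of the negative strengths of the bonds between `A` and its complement. -/
noncomputable def negStrength (α : Assembly T) (A : Set (ℤ × ℤ)) : ℝ≥0∞ :=
  ∑' e : Crossing A, ((-(α.bond e.1.1 e.1.2)).toNat : ℝ≥0∞)

/-- The set `A` separates the tiles of `α` into two nonempty parts, that is, it is a cut of `α`. -/
def IsCut (α : Assembly T) (A : Set (ℤ × ℤ)) : Prop :=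
  (α.dom ∩ A).Nonempty ∧ (α.dom \ A).Nonempty

/-- The strength of the cut `A` of `α`, i.e. `posStrength - negStrength`, is less than `τ`. The
form without subtraction is meaningful for infinite assemblies too; a cut of infinite positive
strength never counts as weak. -/
def CutStrengthLT (α : Assembly T) (A : Set (ℤ × ℤ)) (τ : ℕ) : Prop :=
  α.posStrength A < α.negStrength A + (τ : ℝ≥0∞)

/-- `τ`-stability: every cut has strength at least `τ`. -/
def Stable (τ : ℕ) (α : Assembly T) : Prop :=
  ∀ A, α.IsCut A → ¬ α.CutStrengthLT A τ

open Classical in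
/-- The part of `α` that lies in `A`. -/
noncomputable def restrict (α : Assembly T) (A : Set (ℤ × ℤ)) : Assembly T :=
  fun p => if p ∈ A then α p else none

/-- `β` is obtained from `α` by adding one tile at an empty position, where it binds with total
strength at least `τ`. -/
def Attach (τ : ℕ) (α β : Assembly T) : Prop :=
  ∃ (p : ℤ × ℤ) (t : T), α p = none ∧ β = Function.update α p (some t) ∧
    (τ : ℤ) ≤ ∑ d : Dir, β.bond p d

/-- `α →₋ (β₁, β₂)`: the two assemblies are the two sides of a cut of `α` of strength `≤ 0`
(equivalently `< 1`, since strengths are integers). -/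
def Detach (α β₁ β₂ : Assembly T) : Prop :=
  ∃ A, α.IsCut A ∧ α.CutStrengthLT A 1 ∧ β₁ = α.restrict A ∧ β₂ = α.restrict Aᶜ

/-- `β` is the result of a finite or infinite assembly sequence that starts at `α` and whose steps
are taken from `step`: the last assembly of a finite sequence, the pointwise limit of an infinite
one (if the limit exists and is an assembly, i.e. is nonempty). -/
def Reaches (step : Assembly T → Assembly T → Prop) (α β : Assembly T) : Prop :=
  Relation.ReflTransGen step α β ∨
  ∃ a : ℕ → Assembly T, a 0 = α ∧ (∀ i, step (a i) (a (i + 1))) ∧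
    (∀ p, ∀ᶠ i in Filter.atTop, a i p = β p) ∧ β.dom.Nonempty

end Assembly

/-! ### The two models -/

/-- A tile assembly system of the abstract Tile Assembly Model. -/
structure TAS where
  tiles : Finset TileType
  seed : Assembly tiles
  temperature : ℕ
  strength_nonneg : ∀ t ∈ tiles, ∀ d : Dir, 0 ≤ (t.side d).strength
  seed_finite : seed.dom.Finite
  seed_nonempty : seed.dom.Nonempty
  seed_stable : seed.Stable temperature

namespace TAS

/-- `α →^𝒯 β`. -/
def Reaches (𝒯 : TAS) : Assembly 𝒯.tiles → Assembly 𝒯.tiles → Prop :=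
  Assembly.Reaches (Assembly.Attach 𝒯.temperature)

/-- The set `𝒜[𝒯]` of producible assemblies. -/
def producible (𝒯 : TAS) : Set (Assembly 𝒯.tiles) := {α | 𝒯.Reaches 𝒯.seed α}

end TAS

/-- A system of the restricted glue Tile Assembly Model: temperature `1`, and glue strengths in
`{-1, 0, 1}`. -/
structure RgTAS where
  tiles : Finset TileType
  seed : Assembly tiles
  strength_mem : ∀ t ∈ tiles, ∀ d : Dir, (t.side d).strength ∈ ({-1, 0, 1} : Set ℤ)
  seed_finite : seed.dom.Finite
  seed_nonempty : seed.dom.Nonempty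
  seed_stable : seed.Stable 1

namespace RgTAS

/-- One step of an assembly sequence: a single tile attaches with strength at least `1`, or the
assembly is replaced by one side of a cut of strength `≤ 0`. -/
def Step (𝒮 : RgTAS) (α β : Assembly 𝒮.tiles) : Prop :=
  Assembly.Attach 1 α β ∨ ∃ β', Assembly.Detach α β β'

/-- `α →^𝒮 β`. -/
def Reaches (𝒮 : RgTAS) : Assembly 𝒮.tiles → Assembly 𝒮.tiles → Prop :=
  Assembly.Reaches 𝒮.Step

/-- The set `𝒜[𝒮]` of producible assemblies. -/
def producible (𝒮 : RgTAS) : Set (Assembly 𝒮.tiles) := {α | 𝒮.Reaches 𝒮.seed α}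

end RgTAS

/-! ### Macrotiles and simulation -/

/-- An `m`-block supertile (macrotile) over `S`. -/
abbrev Block (m : ℕ) (S : Finset TileType) := Fin m → Fin m → Option S

namespace Block

variable {m : ℕ} {S T : Finset TileType}

/-- The subassembly relation for macrotiles. -/
def Sub (b c : Block m S) : Prop := ∀ i j s, b i j = some s → c i j = some s

/-- The macrotile has at least one tile. -/
def IsNonempty (b : Block m S) : Prop := ∃ i j, b i j ≠ none

/-- The `m`-block of `α` with macrotile coordinates `x`. -/
def ofAssembly (m : ℕ) (α : Assembly S) (x : ℤ × ℤ) : Block m S :=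
  fun i j => α (m * x.1 + (i : ℕ), m * x.2 + (j : ℕ))

/-- A valid `m`-block supertile representation from `S` to `T`: a partial function that keeps its
value when tiles are added to a macrotile on which it is defined. -/
def ValidRepr (R : Block m S → Option T) : Prop :=
  ∀ b c, Sub b c → ∀ t, R b = some t → R c = some t

/-- The assembly representation function `R*`. -/
def assemblyRepr (R : Block m S → Option T) (α : Assembly S) : Assembly T :=
  fun x => R (ofAssembly m α x)

/-- `α` maps cleanly to `R*(α)`: each nonempty block has the coordinates of a tile of `R*(α)`, or
coordinates next to (not diagonally) those of such a tile; or at most one block is nonempty. -/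
def MapsCleanly (R : Block m S → Option T) (α : Assembly S) : Prop :=
  (∀ x, (ofAssembly m α x).IsNonempty →
    ∃ u : ℤ × ℤ, u.1 ^ 2 + u.2 ^ 2 ≤ 1 ∧ x + u ∈ (assemblyRepr R α).dom) ∨
  (∀ x y, (ofAssembly m α x).IsNonempty → (ofAssembly m α y).IsNonempty → x = y)

/-- `β` is contained in a single macrotile (located at some block `x`) on which `R` is undefined,
so that it represents the empty tile. -/
def InEmptyBlock (R : Block m S → Option T) (β : Assembly S) : Prop :=
  ∃ (x : ℤ × ℤ) (γ : Block m S), R γ = none ∧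
    ∀ p s, β p = some s → ∃ i j : Fin m,
      p = ((m : ℤ) * x.1 + (i : ℕ), (m : ℤ) * x.2 + (j : ℕ)) ∧ γ i j = some s

end Block

namespace RgTAS

open Block

variable (𝒮 : RgTAS) (𝒯 : TAS) {m : ℕ} (R : Block m 𝒮.tiles → Option 𝒯.tiles)

/-- Equivalent productions. Producible assemblies of `𝒮` that represent the empty assembly are the
detached junk; they do not take part in the comparison of the productions. -/
def EquivalentProductions : Prop :=
  {α : Assembly 𝒯.tiles | α ≠ Assembly.empty ∧ ∃ α' ∈ 𝒮.producible, assemblyRepr R α' = α}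
    = 𝒯.producible ∧
  ∀ α' ∈ 𝒮.producible, MapsCleanly R α'

/-- Of the two sides of a cut of `α'`, the side `β` keeps the seed and still represents the same
assembly, and the side `δ` is junk: it, and all that it can turn into, represents the empty tile. -/
def KeepsAndSheds (α' β δ : Assembly 𝒮.tiles) : Prop :=
  𝒮.seed.Sub β ∧ assemblyRepr R α' = assemblyRepr R β ∧ InEmptyBlock R δ ∧
  ∀ δ' ∈ 𝒮.producible, 𝒮.Reaches δ δ' → InEmptyBlock R δ'

/-- `𝒯` follows `𝒮`. The condition on cuts is imposed on the assemblies that represent an assembly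
of `𝒯`; junk may fall apart further. -/
def IsFollowedBy : Prop :=
  (∀ α' ∈ 𝒮.producible, ∀ β' ∈ 𝒮.producible, Assembly.Attach 1 α' β' →
    𝒯.Reaches (assemblyRepr R α') (assemblyRepr R β')) ∧
  (∀ α' ∈ 𝒮.producible, ∀ β₁ ∈ 𝒮.producible, ∀ β₂ ∈ 𝒮.producible,
    assemblyRepr R α' ∈ 𝒯.producible → Assembly.Detach α' β₁ β₂ →
      𝒮.KeepsAndSheds 𝒯 R α' β₁ β₂ ∨ 𝒮.KeepsAndSheds 𝒯 R α' β₂ β₁)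

/-- `𝒮` models `𝒯`. -/
def Models : Prop :=
  ∀ α ∈ 𝒯.producible, ∃ P : Set (Assembly 𝒮.tiles), P ⊆ 𝒮.producible ∧
    (∀ α' ∈ P, assemblyRepr R α' = α) ∧
    ∀ β ∈ 𝒯.producible, 𝒯.Reaches α β →
      (∀ α' ∈ P, ∃ β' ∈ 𝒮.producible, assemblyRepr R β' = β ∧ 𝒮.Reaches α' β') ∧
      (∀ α'' ∈ 𝒮.producible, ∀ β' ∈ 𝒮.producible, 𝒮.Reaches α'' β' →
        assemblyRepr R α'' = α → assemblyRepr R β' = β → ∃ α' ∈ P, 𝒮.Reaches α' α'')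

/-- `𝒮` simulates `𝒯` under the `m`-block representation `R`. -/
def SimulatesUnder : Prop :=
  𝒮.EquivalentProductions 𝒯 R ∧ 𝒮.IsFollowedBy 𝒯 R ∧ 𝒮.Models 𝒯 R

/-- `𝒮` simulates `𝒯`, at some scale factor `m ≥ 1` under some valid representation. -/
def Simulates : Prop :=
  ∃ (m : ℕ) (R : Block m 𝒮.tiles → Option 𝒯.tiles),
    0 < m ∧ ValidRepr R ∧ 𝒮.SimulatesUnder 𝒯 R

end RgTAS

/-! ### The finger and flagpole system -/

namespace FingerFlagpole

/-- The empty side: no glue. -/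
def o : Glue := ⟨0, 0⟩

/-- The glues `g 1, …, g 16`: `g 11` and `g 14` have strength `1`, all others strength `2`. -/
def g (i : ℕ) : Glue := ⟨i, if i = 11 ∨ i = 14 then 1 else 2⟩

/-- The seed tile; the fields of a tile are its north, east, south and west glue. -/
def seedTile : TileType := ⟨g 1, o, g 4, o⟩

/-- The keystone tile: it binds to the tips of the two fingers, with strength `1` to each. -/
def keystone : TileType := ⟨g 11, g 15, g 14, o⟩

/-- The flagpole, east of the keystone. -/
def flagpole : TileType := ⟨o, g 16, o, g 15⟩

/-- The flag, east of the flagpole. -/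
def flag : TileType := ⟨o, o, o, g 16⟩

/-- From the seed three tiles north; then the top arm, a row of arbitrary length growing east; then
the top finger, growing south from the end of the arm. -/
def topTiles : Finset TileType :=
  { ⟨g 2, o, g 1, o⟩, ⟨g 3, o, g 2, o⟩, ⟨o, g 7, g 3, o⟩, -- column, and corner
    ⟨o, g 7, o, g 7⟩, -- repeating arm tile
    ⟨o, o, g 9, g 7⟩, ⟨g 9, o, g 10, o⟩, ⟨g 10, o, g 11, o⟩ } -- finger

/-- The mirror image: three tiles south of the seed; then the bottom arm, growing east; then the
bottom finger, growing north. -/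
def bottomTiles : Finset TileType :=
  { ⟨g 4, o, g 5, o⟩, ⟨g 5, o, g 6, o⟩, ⟨g 6, g 8, o, o⟩, -- column, and corner
    ⟨o, g 8, o, g 8⟩, -- repeating arm tile
    ⟨g 12, o, o, g 8⟩, ⟨g 13, o, g 12, o⟩, ⟨g 14, o, g 13, o⟩ } -- finger

/-- The 18 tile types. -/
def tiles : Finset TileType :=
  {seedTile, keystone, flagpole, flag} ∪ (topTiles ∪ bottomTiles)

theorem card_tiles : tiles.card = 18 := by decide

/-- The seed assembly: the seed tile at the origin. -/
def seed : Assembly tiles :=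
  fun p => if p = (0, 0) then some ⟨seedTile, by decide⟩ else none

theorem seed_dom : seed.dom = {(0, 0)} := by
  ext p
  simp [Assembly.dom, seed]

/-- The finger and flagpole system, at temperature `2`. -/
def system : TAS where
  tiles := tiles
  seed := seed
  temperature := 2
  strength_nonneg := by decide
  seed_finite := by simp [seed_dom]
  seed_nonempty := by simp [seed_dom]
  seed_stable := by
    rintro A ⟨⟨p, hp, hpA⟩, ⟨q, hq, hqA⟩⟩
    rw [seed_dom] at hp hq
    rw [Set.mem_singleton_iff] at hp hq
    subst hp hq
    exact absurd hpA hqA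

end FingerFlagpole

/-! ### Generalities on assemblies -/

/-! The keystone needs both fingers, but at temperature 1 with integer strengths such cooperation
can be faked by one finger alone: if the bonds to the top part and to the bottom part together have
strength at least 1, then one of the two contributions is already at least 1.

Suppose that 𝒮 simulates the system. For arms of length `n`, the finite assembly with keystone,
flagpole and flag has a representative `β` with the fewest tiles. A cut of strength at most 0 would
shed junk and leave a smaller representative, so `β` is 1-stable (`exists_stable_repr`). Negative
glues are thereby tamed: `β` can be regrown from the seed, because some missing tile always binds to
the part already present with strength at least 1 (`Stable.exists_bound_tile`).

During this regrowth each tile is labelled left, top or bottom, and a top or bottom tile is required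
to bind using only the tiles of its own side and of the left. By the remark on integers this never
gets stuck. As the block of the flag belongs to no zone, eventually a tile escapes: supported by one
side only, it wants to enter a block near the keystone that lies outside of the zone of that side
(`exists_escapes`).

The left meets the two arms along a window whose size does not depend on `n`. The ordered list of
placements in the window takes finitely many values, so two lengths `n' < n` share it. Then the two
growths can be spliced: the side opposite to the escaping one is taken from the short world,
everything else from the long one (`reaches_of_splice`). The opposite finger is now far away, yet
the tile still escapes at the keystone of the long world. Without the opposite finger, 𝒯 can have no
tile in or next to the block of the escaped tile (`eq_none_of_exit`), so the resulting producible
assembly does not map cleanly (`not_same_window`). -/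

theorem Dir.opp_opp (d : Dir) : d.opp.opp = d := by cases d <;> rfl

theorem Dir.vec_opp (d : Dir) : d.opp.vec = -d.vec := by cases d <;> rfl

theorem Dir.add_vec_ne (p : ℤ × ℤ) (d : Dir) : p + d.vec ≠ p := by
  intro h
  have h' : d.vec = 0 := by simpa using h
  cases d <;> simp [Dir.vec] at h'

theorem bondStrength_comm (s t : TileType) (d : Dir) :
    bondStrength t s d.opp = bondStrength s t d := by
  unfold bondStrength
  rw [Dir.opp_opp]
  by_cases h : s.side d = t.side d.opp
  · rw [if_pos h, if_pos h.symm, h]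
  · rw [if_neg h, if_neg (Ne.symm h)]

namespace Assembly

variable {T : Finset TileType}

theorem mem_dom {α : Assembly T} {p : ℤ × ℤ} : p ∈ α.dom ↔ ∃ t, α p = some t :=
  Option.ne_none_iff_exists'

theorem Sub.refl (α : Assembly T) : α.Sub α := fun _ _ h => h

theorem Sub.trans {α β γ : Assembly T} (h : α.Sub β) (h' : β.Sub γ) : α.Sub γ :=
  fun p t hp => h' p t (h p t hp)

theorem Sub.dom_subset {α β : Assembly T} (h : α.Sub β) : α.dom ⊆ β.dom := by
  intro p hp
  obtain ⟨t, ht⟩ := mem_dom.1 hp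
  exact mem_dom.2 ⟨t, h p t ht⟩

theorem eq_empty_of_sub_empty {α : Assembly T} (h : α.Sub empty) : α = empty := by
  funext p
  by_contra hp
  obtain ⟨t, ht⟩ := Option.ne_none_iff_exists'.1 hp
  exact absurd (h p t ht) (by simp [empty])

theorem dom_nonempty_of_ne_empty {α : Assembly T} (h : α ≠ empty) : α.dom.Nonempty := by
  by_contra hn
  apply h
  funext p
  by_contra hp
  exact hn ⟨p, hp⟩

theorem restrict_sub (α : Assembly T) (A : Set (ℤ × ℤ)) : (α.restrict A).Sub α := by
  intro p t h
  unfold restrict at h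
  split_ifs at h
  exact h

theorem dom_restrict (α : Assembly T) (A : Set (ℤ × ℤ)) : (α.restrict A).dom = α.dom ∩ A := by
  ext p
  by_cases h : p ∈ A <;> simp [dom, restrict, h]

theorem bond_symm (α : Assembly T) (p : ℤ × ℤ) (d : Dir) :
    α.bond (p + d.vec) d.opp = α.bond p d := by
  have hp : p + d.vec + d.opp.vec = p := by rw [Dir.vec_opp]; simp
  unfold bond
  rw [hp]
  cases h : α p <;> cases h' : α (p + d.vec) <;> simp [bondStrength_comm]

/-- Reversal of the edges identifies the crossings of a set with those of its complement. -/
def crossingCompl (A : Set (ℤ × ℤ)) : Crossing A ≃ Crossing Aᶜ where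
  toFun e := ⟨(e.1.1 + e.1.2.vec, e.1.2.opp), e.2.2, by
    have := e.2.1
    simpa [Dir.vec_opp] using this⟩
  invFun e := ⟨(e.1.1 + e.1.2.vec, e.1.2.opp), by
    have h1 := e.2.1
    have h2 := e.2.2
    refine ⟨by simpa using h2, by simpa [Dir.vec_opp] using h1⟩⟩
  left_inv e := by
    apply Subtype.ext
    simp [Dir.vec_opp, Dir.opp_opp]
  right_inv e := by
    apply Subtype.ext
    simp [Dir.vec_opp, Dir.opp_opp]

theorem posStrength_compl (α : Assembly T) (A : Set (ℤ × ℤ)) :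
    α.posStrength Aᶜ = α.posStrength A := by
  unfold posStrength
  rw [← (crossingCompl A).tsum_eq]
  simp [crossingCompl, bond_symm]

theorem negStrength_compl (α : Assembly T) (A : Set (ℤ × ℤ)) :
    α.negStrength Aᶜ = α.negStrength A := by
  unfold negStrength
  rw [← (crossingCompl A).tsum_eq]
  simp [crossingCompl, bond_symm]

theorem IsCut.compl {α : Assembly T} {A : Set (ℤ × ℤ)} (h : α.IsCut A) : α.IsCut Aᶜ := by
  refine ⟨h.2, ?_⟩
  have := h.1
  rwa [Set.sdiff_compl]

theorem Detach.symm {α β₁ β₂ : Assembly T} (h : Detach α β₁ β₂) : Detach α β₂ β₁ := by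
  obtain ⟨A, hA, hlt, rfl, rfl⟩ := h
  refine ⟨Aᶜ, hA.compl, ?_, rfl, by rw [compl_compl]⟩
  unfold CutStrengthLT
  rw [posStrength_compl, negStrength_compl]
  exact hlt

/-- Edges that start at an untiled position carry bond 0, so `f 0 = 0` reduces the series to a
finite sum, grouped by the endpoint outside of `A`. It serves for positive and negative parts alike.
-/
theorem tsum_crossing_compl {α : Assembly T} (hfin : α.dom.Finite) (A : Set (ℤ × ℤ))
    (f : ℤ → ℕ) (hf : f 0 = 0) :
    (∑' e : Crossing Aᶜ, (f (α.bond e.1.1 e.1.2) : ℝ≥0∞)) =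
      ((∑ p ∈ hfin.toFinset, ∑ d : Dir,
        open Classical in if p ∉ A ∧ p + d.vec ∈ A then f (α.bond p d) else 0 : ℕ) : ℝ≥0∞) := by
  classical
  rw [tsum_subtype (Crossing Aᶜ) (fun e => (f (α.bond e.1 e.2) : ℝ≥0∞)),
    tsum_eq_sum (s := hfin.toFinset ×ˢ Finset.univ)]
  · rw [Finset.sum_product]
    push_cast
    refine Finset.sum_congr rfl fun p _ => Finset.sum_congr rfl fun d _ => ?_
    by_cases h : p ∉ A ∧ p + d.vec ∈ A
    · rw [if_pos h, Set.indicator_of_mem]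
      simpa [Crossing] using h
    · rw [if_neg h, Set.indicator_of_notMem]
      simpa [Crossing] using h
  · rintro ⟨p, d⟩ hp
    have hp' : α p = none := by
      by_contra hne
      exact hp (Finset.mem_product.2 ⟨hfin.mem_toFinset.2 hne, Finset.mem_univ _⟩)
    have : α.bond p d = 0 := by simp [bond, hp']
    by_cases h : (p, d) ∈ Crossing Aᶜ
    · rw [Set.indicator_of_mem h]
      simp [this, hf]
    · rw [Set.indicator_of_notMem h]

/-- In a finite `1`-stable assembly, some tile outside of a given part binds to that part with
strength at least `1`. -/
theorem Stable.exists_bound_tile {β : Assembly T} (hst : β.Stable 1) (hfin : β.dom.Finite)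
    (A : Set (ℤ × ℤ)) (hA : (β.dom ∩ A).Nonempty) (hA' : (β.dom \ A).Nonempty) :
    ∃ p ∈ β.dom \ A, 1 ≤ ∑ d : Dir,
      open Classical in if p + d.vec ∈ A then β.bond p d else 0 := by
  classical
  by_contra hcon
  push Not at hcon
  have hcut : β.IsCut A := ⟨hA, hA'⟩
  -- The cut strength is the sum, over the tiles outside of `A`, of their bonds into `A`. If each
  -- such tile contributed at most 0, the strength could not be 1.
  have h := hst _ hcut.compl
  unfold CutStrengthLT posStrength negStrength at h
  rw [not_lt, tsum_crossing_compl hfin A Int.toNat rfl,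
    tsum_crossing_compl hfin A (fun z => (-z).toNat) rfl] at h
  have h' : (∑ p ∈ hfin.toFinset, ∑ d : Dir,
        if p ∉ A ∧ p + d.vec ∈ A then (-(β.bond p d)).toNat else 0) + 1 ≤
      ∑ p ∈ hfin.toFinset, ∑ d : Dir,
        if p ∉ A ∧ p + d.vec ∈ A then (β.bond p d).toNat else 0 := by
    exact_mod_cast h
  have h'' : ((∑ p ∈ hfin.toFinset, ∑ d : Dir,
        if p ∉ A ∧ p + d.vec ∈ A then (-(β.bond p d)).toNat else 0 : ℕ) : ℤ) + 1 ≤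
      ((∑ p ∈ hfin.toFinset, ∑ d : Dir,
        if p ∉ A ∧ p + d.vec ∈ A then (β.bond p d).toNat else 0 : ℕ) : ℤ) := by
    exact_mod_cast h'
  have hle : ((∑ p ∈ hfin.toFinset, ∑ d : Dir,
        if p ∉ A ∧ p + d.vec ∈ A then (β.bond p d).toNat else 0 : ℕ) : ℤ) ≤
      ((∑ p ∈ hfin.toFinset, ∑ d : Dir,
        if p ∉ A ∧ p + d.vec ∈ A then (-(β.bond p d)).toNat else 0 : ℕ) : ℤ) := by
    push_cast
    refine Finset.sum_le_sum fun p hp => ?_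
    rw [← sub_nonpos, ← Finset.sum_sub_distrib]
    by_cases hpA : p ∈ A
    · simp [hpA]
    · have hb := hcon p ⟨by simpa using hp, hpA⟩
      refine le_trans (le_of_eq ?_) (Int.lt_add_one_iff.1 (by simpa using hb))
      refine Finset.sum_congr rfl fun d _ => ?_
      by_cases hd : p + d.vec ∈ A
      · simp only [hpA, hd, not_false_eq_true, and_self, if_true]
        omega
      · simp [hd]
  omega

/-! ### Growth by attachment -/

theorem Attach.sub {τ : ℕ} {α β : Assembly T} (h : Attach τ α β) : α.Sub β := by
  obtain ⟨p, t, hp, rfl, -⟩ := h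
  intro q s hq
  rw [Function.update_of_ne]
  · exact hq
  · rintro rfl
    rw [hp] at hq
    exact absurd hq (by simp)

theorem Attach.dom_finite {τ : ℕ} {α β : Assembly T} (h : Attach τ α β) (hα : α.dom.Finite) :
    β.dom.Finite := by
  obtain ⟨p, t, hp, rfl, -⟩ := h
  refine (hα.insert p).subset fun q hq => ?_
  by_cases hqp : q = p
  · exact Or.inl hqp
  · right
    simpa [dom, Function.update_of_ne hqp] using hq

theorem sub_of_chain {a : ℕ → Assembly T} (h : ∀ i, (a i).Sub (a (i + 1))) {i j : ℕ}
    (hij : i ≤ j) : (a i).Sub (a j) := by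
  induction hij with
  | refl => exact Sub.refl _
  | step _ ih => exact ih.trans (h _)

theorem sub_limit {a : ℕ → Assembly T} {β : Assembly T} (h : ∀ i, (a i).Sub (a (i + 1)))
    (hlim : ∀ p, ∀ᶠ i in Filter.atTop, a i p = β p) (i : ℕ) : (a i).Sub β := by
  intro p t hp
  obtain ⟨N, hN⟩ := Filter.eventually_atTop.1 (hlim p)
  rw [← hN (max i N) (le_max_right _ _)]
  exact sub_of_chain h (le_max_left _ _) p t hp

theorem Reaches.sub {τ : ℕ} {α β : Assembly T} (h : Reaches (Attach τ) α β) : α.Sub β := by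
  rcases h with h | ⟨a, rfl, hstep, hlim, -⟩
  · induction h with
    | refl => exact Sub.refl _
    | tail _ h ih => exact ih.trans h.sub
  · exact sub_limit (fun i => (hstep i).sub) hlim 0

theorem not_attach_empty {τ : ℕ} (hτ : 0 < τ) (β : Assembly T) : ¬ Attach τ empty β := by
  rintro ⟨p, t, -, rfl, h⟩
  have : ∑ d : Dir, bond (Function.update (empty : Assembly T) p (some t)) p d = 0 := by
    refine Finset.sum_eq_zero fun d _ => ?_
    unfold bond
    rw [Function.update_of_ne (Dir.add_vec_ne p d)]
    simp [empty]
  omega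

/-- A tile without neighbours binds with strength 0. Hence an assembly of 𝒮 that represents nothing
cannot come to represent something by attachments. -/
theorem Reaches.eq_empty {τ : ℕ} (hτ : 0 < τ) {β : Assembly T}
    (h : Reaches (Attach τ) empty β) : β = empty := by
  rcases h with h | ⟨a, h0, hstep, -, -⟩
  · rcases Relation.ReflTransGen.cases_head h with h | ⟨γ, h, -⟩
    · exact h.symm
    · exact absurd h (not_attach_empty hτ γ)
  · have := hstep 0
    rw [h0] at this
    exact absurd this (not_attach_empty hτ _)

/-- The total strength with which a tile `t` placed at `p` binds to its neighbours in `α`. -/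
def glueSum (α : Assembly T) (p : ℤ × ℤ) (t : T) : ℤ :=
  ∑ d : Dir, ((α (p + d.vec)).elim 0 fun s => bondStrength t s d)

theorem bond_update (α : Assembly T) (p : ℤ × ℤ) (t : T) (d : Dir) :
    bond (Function.update α p (some t)) p d =
      (α (p + d.vec)).elim 0 fun s => bondStrength t s d := by
  unfold bond
  rw [Function.update_self, Function.update_of_ne (Dir.add_vec_ne p d)]
  cases α (p + d.vec) <;> rfl

theorem attach_of_glueSum {τ : ℕ} {α : Assembly T} {p : ℤ × ℤ} {t : T} (hp : α p = none)
    (h : (τ : ℤ) ≤ α.glueSum p t) : Attach τ α (Function.update α p (some t)) := by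
  refine ⟨p, t, hp, rfl, ?_⟩
  simp only [bond_update]
  exact h

theorem glueSum_congr {α α' : Assembly T} {p : ℤ × ℤ} (t : T)
    (h : ∀ d : Dir, α (p + d.vec) = α' (p + d.vec)) : α.glueSum p t = α'.glueSum p t := by
  unfold glueSum
  simp only [h]

end Assembly

/-! ### Macrotiles -/

namespace Block

variable {m : ℕ} {S T : Finset TileType}

/-- The coordinates of the `m`-block that contains a position. -/
def coord (m : ℕ) (p : ℤ × ℤ) : ℤ × ℤ := (p.1 / m, p.2 / m)

theorem coord_pos (x : ℤ × ℤ) (i j : Fin m) :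
    coord m ((m : ℤ) * x.1 + (i : ℕ), (m : ℤ) * x.2 + (j : ℕ)) = x := by
  have hi := i.2
  have hj := j.2
  have hm : (0 : ℤ) < m := by omega
  have key : ∀ (a : ℤ) (k : ℕ), k < m → ((m : ℤ) * a + k) / m = a := by
    intro a k hk
    rw [add_comm, Int.add_mul_ediv_left _ _ hm.ne', Int.ediv_eq_zero_of_lt (by omega) (by omega)]
    simp
  simp only [coord, key _ _ hi, key _ _ hj]

theorem exists_pos (hm : 0 < m) (p : ℤ × ℤ) : ∃ i j : Fin m,
    p = ((m : ℤ) * (coord m p).1 + (i : ℕ), (m : ℤ) * (coord m p).2 + (j : ℕ)) := by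
  have hm' : (0 : ℤ) < m := by omega
  have key : ∀ a : ℤ, ∃ i : Fin m, a = (m : ℤ) * (a / m) + (i : ℕ) := by
    intro a
    have h1 := Int.emod_nonneg a hm'.ne'
    have h2 := Int.emod_lt_of_pos a hm'
    refine ⟨⟨(a % m).toNat, by omega⟩, ?_⟩
    have h3 := Int.mul_ediv_add_emod a m
    simp only [Int.toNat_of_nonneg h1]
    exact h3.symm
  obtain ⟨i, hi⟩ := key p.1
  obtain ⟨j, hj⟩ := key p.2
  exact ⟨i, j, Prod.ext hi hj⟩

theorem isNonempty_ofAssembly (hm : 0 < m) {α : Assembly S} {p : ℤ × ℤ} (hp : p ∈ α.dom) :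
    (ofAssembly m α (coord m p)).IsNonempty := by
  obtain ⟨i, j, hij⟩ := exists_pos hm p
  refine ⟨i, j, ?_⟩
  unfold ofAssembly
  rw [← hij]
  exact hp

theorem ofAssembly_sub {α β : Assembly S} {x : ℤ × ℤ}
    (h : ∀ p s, coord m p = x → α p = some s → β p = some s) :
    Sub (ofAssembly m α x) (ofAssembly m β x) :=
  fun i j s hs => h _ s (coord_pos x i j) hs

theorem assemblyRepr_sub_at {R : Block m S → Option T} (hR : ValidRepr R) {α β : Assembly S}
    {x : ℤ × ℤ} (h : ∀ p s, coord m p = x → α p = some s → β p = some s) {t : T}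
    (ht : assemblyRepr R α x = some t) : assemblyRepr R β x = some t :=
  hR _ _ (ofAssembly_sub h) t ht

theorem assemblyRepr_mono {R : Block m S → Option T} (hR : ValidRepr R) {α β : Assembly S}
    (h : α.Sub β) : (assemblyRepr R α).Sub (assemblyRepr R β) :=
  fun _ _ hx => assemblyRepr_sub_at hR (fun p s _ => h p s) hx

/-- Every block of `δ`, the empty ones included, is a subblock of `γ`; by validity a value of `R`
there would persist on `γ`. -/
theorem InEmptyBlock.assemblyRepr_eq {R : Block m S → Option T} (hR : ValidRepr R)
    {δ : Assembly S} (h : InEmptyBlock R δ) : assemblyRepr R δ = Assembly.empty := by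
  obtain ⟨x, γ, hγ, h⟩ := h
  funext z
  by_contra hne
  obtain ⟨t, ht⟩ := Option.ne_none_iff_exists'.1 hne
  have hsub : Sub (ofAssembly m δ z) γ := by
    intro i j s hs
    obtain ⟨i', j', hp, hg⟩ := h _ s hs
    have hz : z = x := by rw [← coord_pos z i j, hp, coord_pos]
    subst hz
    have h1 : i = i' := by
      have := congrArg Prod.fst hp
      apply Fin.ext
      simp only at this
      omega
    have h2 : j = j' := by
      have := congrArg Prod.snd hp
      apply Fin.ext
      simp only at this
      omega
    rw [h1, h2]
    exact hg
  have := hR _ _ hsub t ht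
  rw [hγ] at this
  exact absurd this (by simp)

end Block

/-! ### Consequences of a simulation -/

namespace TAS

theorem seed_mem_producible (𝒯 : TAS) : 𝒯.seed ∈ 𝒯.producible :=
  Or.inl Relation.ReflTransGen.refl

end TAS

namespace RgTAS

open Block Assembly

variable {𝒮 : RgTAS} {𝒯 : TAS} {m : ℕ} {R : Block m 𝒮.tiles → Option 𝒯.tiles}

/-- `α` is the result of a finite assembly sequence of `𝒮`. -/
def FinProducible (𝒮 : RgTAS) (α : Assembly 𝒮.tiles) : Prop :=
  Relation.ReflTransGen 𝒮.Step 𝒮.seed α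

theorem FinProducible.mem {α : Assembly 𝒮.tiles} (h : 𝒮.FinProducible α) : α ∈ 𝒮.producible :=
  Or.inl h

theorem FinProducible.dom_finite {α : Assembly 𝒮.tiles} (h : 𝒮.FinProducible α) :
    α.dom.Finite := by
  induction h with
  | refl => exact 𝒮.seed_finite
  | tail _ h ih =>
    rcases h with h | ⟨_, A, -, -, rfl, -⟩
    · exact h.dom_finite ih
    · exact ih.subset (restrict_sub _ _).dom_subset

theorem SimulatesUnder.repr_mem (h : 𝒮.SimulatesUnder 𝒯 R) {α : Assembly 𝒮.tiles}
    (hα : α ∈ 𝒮.producible) (hne : assemblyRepr R α ≠ empty) :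
    assemblyRepr R α ∈ 𝒯.producible := by
  rw [← h.1.1]
  exact ⟨hne, α, hα, rfl⟩

theorem SimulatesUnder.exists_repr (h : 𝒮.SimulatesUnder 𝒯 R) {α : Assembly 𝒯.tiles}
    (hα : α ∈ 𝒯.producible) : α ≠ empty ∧ ∃ α' ∈ 𝒮.producible, assemblyRepr R α' = α := by
  rw [← h.1.1] at hα
  exact hα

/-- Otherwise validity would make `R` defined on every block, whereas some assembly represents the
finite seed of 𝒯. -/
theorem SimulatesUnder.repr_emptyBlock (h : 𝒮.SimulatesUnder 𝒯 R) (hR : ValidRepr R) :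
    R (fun _ _ => none) = none := by
  by_contra hne
  obtain ⟨t, ht⟩ := Option.ne_none_iff_exists'.1 hne
  obtain ⟨-, α', -, hα'⟩ := h.exists_repr 𝒯.seed_mem_producible
  obtain ⟨x, hx⟩ := 𝒯.seed_finite.exists_notMem
  apply hx
  have : assemblyRepr R α' x = some t := hR _ _ (fun i j s hs => absurd hs (by simp)) t ht
  rw [← hα']
  exact mem_dom.2 ⟨t, this⟩

/-- One step of `𝒮` either yields junk, or lets the represented assembly grow and keeps the
seed. -/
theorem SimulatesUnder.step (h : 𝒮.SimulatesUnder 𝒯 R) (hR : ValidRepr R)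
    (hτ : 0 < 𝒯.temperature) {α β : Assembly 𝒮.tiles} (hα : 𝒮.FinProducible α)
    (hs : 𝒮.Step α β) :
    assemblyRepr R β = empty ∨ assemblyRepr R α ≠ empty ∧
      (assemblyRepr R α).Sub (assemblyRepr R β) ∧ (𝒮.seed.Sub α → 𝒮.seed.Sub β) := by
  have hβ : 𝒮.FinProducible β := hα.tail hs
  by_cases hne : assemblyRepr R α = empty
  · left
    rcases hs with hs | ⟨_, A, -, -, rfl, -⟩
    · have := h.2.1.1 α hα.mem β hβ.mem hs
      rw [hne] at this
      exact Reaches.eq_empty hτ this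
    · apply eq_empty_of_sub_empty
      rw [← hne]
      exact assemblyRepr_mono hR (restrict_sub _ _)
  · rcases hs with hs | ⟨β', hs⟩
    · exact Or.inr ⟨hne, (h.2.1.1 α hα.mem β hβ.mem hs).sub, fun hsub => hsub.trans hs.sub⟩
    · have hβ' : 𝒮.FinProducible β' := hα.tail (Or.inr ⟨β, hs.symm⟩)
      rcases h.2.1.2 α hα.mem β hβ.mem β' hβ'.mem (h.repr_mem hα.mem hne) hs with hk | hk
      · refine Or.inr ⟨hne, ?_, fun _ => hk.1⟩
        rw [hk.2.1]
        exact Sub.refl _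
      · exact Or.inl (hk.2.2.1.assemblyRepr_eq hR)

/-- Junk never represents anything again. So every earlier assembly of the sequence represents
something, and each detachment along it keeps the side with the seed. -/
theorem SimulatesUnder.seed_sub (h : 𝒮.SimulatesUnder 𝒯 R) (hR : ValidRepr R)
    (hτ : 0 < 𝒯.temperature) {α : Assembly 𝒮.tiles} (hα : 𝒮.FinProducible α)
    (hne : assemblyRepr R α ≠ empty) : 𝒮.seed.Sub α := by
  induction hα with
  | refl => exact Sub.refl _
  | tail hab hs ih =>
    rcases h.step hR hτ hab hs with h' | ⟨h1, -, h3⟩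
    · exact absurd h' hne
    · exact h3 (ih h1)

/-- In an assembly that represents something, each tile lies in or next to a block on which `R` is
defined. -/
theorem SimulatesUnder.clean (h : 𝒮.SimulatesUnder 𝒯 R) (hR : ValidRepr R) (hm : 0 < m)
    {α : Assembly 𝒮.tiles} (hα : α ∈ 𝒮.producible) (hne : assemblyRepr R α ≠ empty)
    {p : ℤ × ℤ} (hp : p ∈ α.dom) :
    ∃ u : ℤ × ℤ, u.1 ^ 2 + u.2 ^ 2 ≤ 1 ∧ coord m p + u ∈ (assemblyRepr R α).dom := by
  rcases h.1.2 α hα with hc | hc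
  · exact hc _ (isNonempty_ofAssembly hm hp)
  -- With at most one nonempty block, that block is the represented one, since `R` is undefined on
  -- the empty block.
  · obtain ⟨x, hx⟩ := dom_nonempty_of_ne_empty hne
    have hxn : (ofAssembly m α x).IsNonempty := by
      by_contra hcon
      unfold IsNonempty at hcon
      push Not at hcon
      apply hx
      have : ofAssembly m α x = fun _ _ => none := by
        funext i j
        exact hcon i j
      unfold assemblyRepr
      rw [this, h.repr_emptyBlock hR]
    refine ⟨0, by simp, ?_⟩
    rw [hc _ _ (isNonempty_ofAssembly hm hp) hxn, add_zero]
    exact hx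

theorem finite_near_blocks (hm : 0 < m) {D : Set (ℤ × ℤ)} (hD : D.Finite) :
    {p : ℤ × ℤ | ∃ u : ℤ × ℤ, u.1 ^ 2 + u.2 ^ 2 ≤ 1 ∧ coord m p + u ∈ D}.Finite := by
  have hfin : (⋃ z ∈ D, ⋃ v ∈ Set.Icc (-1 : ℤ) 1 ×ˢ Set.Icc (-1 : ℤ) 1,
      ⋃ i : Fin m, ⋃ j : Fin m,
        {((m : ℤ) * (z - v).1 + (i : ℕ), (m : ℤ) * (z - v).2 + (j : ℕ))}).Finite := by
    refine hD.biUnion fun z _ => ?_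
    refine ((Set.finite_Icc _ _).prod (Set.finite_Icc _ _)).biUnion fun v _ => ?_
    exact Set.finite_iUnion fun i => Set.finite_iUnion fun j => Set.finite_singleton _
  refine hfin.subset ?_
  rintro p ⟨u, hu, hmem⟩
  obtain ⟨i, j, hij⟩ := exists_pos hm p
  simp only [Set.mem_iUnion]
  refine ⟨_, hmem, u, ?_, i, j, ?_⟩
  · simp only [Set.mem_prod, Set.mem_Icc]
    refine ⟨⟨?_, ?_⟩, ?_, ?_⟩ <;> nlinarith [sq_nonneg u.1, sq_nonneg u.2]
  · rw [add_sub_cancel_right]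
    exact hij

/-- A producible assembly that represents a finite assembly is producible in finitely many
steps. -/
theorem SimulatesUnder.finProducible (h : 𝒮.SimulatesUnder 𝒯 R) (hR : ValidRepr R) (hm : 0 < m)
    (hτ : 0 < 𝒯.temperature) {α : Assembly 𝒮.tiles} (hα : α ∈ 𝒮.producible)
    (hne : assemblyRepr R α ≠ empty) (hfin : (assemblyRepr R α).dom.Finite) :
    𝒮.FinProducible α := by
  rcases hα with hα | ⟨a, h0, hstep, hlim, -⟩
  · exact hα
  have hprod : ∀ i, 𝒮.FinProducible (a i) := by
    intro i
    induction i with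
    | zero => rw [h0]; exact Relation.ReflTransGen.refl
    | succ i ih => exact ih.tail (hstep i)
  have hlimR : ∀ x, ∀ᶠ i in Filter.atTop, assemblyRepr R (a i) x = assemblyRepr R α x := by
    intro x
    have : ∀ᶠ i in Filter.atTop, ∀ k l : Fin m,
        ofAssembly m (a i) x k l = ofAssembly m α x k l :=
      Filter.eventually_all.2 fun k => Filter.eventually_all.2 fun l => hlim _
    filter_upwards [this] with i hi
    unfold assemblyRepr
    congr 1
    funext k l
    exact hi k l
  -- Representing nothing is permanent, so it would pass to the limit.
  have hnonempty : ∀ i, assemblyRepr R (a i) ≠ empty := by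
    intro i hi
    have hall : ∀ j, i ≤ j → assemblyRepr R (a j) = empty := by
      intro j hj
      induction hj with
      | refl => exact hi
      | step _ ih =>
        rcases h.step hR hτ (hprod _) (hstep _) with h' | ⟨h', -⟩
        · exact h'
        · exact absurd ih h'
    apply hne
    funext x
    obtain ⟨N, hN⟩ := Filter.eventually_atTop.1 (hlimR x)
    rw [← hN (max i N) (le_max_right _ _), hall _ (le_max_left _ _)]
  have hmono : ∀ i, (assemblyRepr R (a i)).Sub (assemblyRepr R (a (i + 1))) := by
    intro i
    rcases h.step hR hτ (hprod i) (hstep i) with h' | ⟨-, h', -⟩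
    · exact absurd h' (hnonempty _)
    · exact h'
  have hsub : ∀ i, (assemblyRepr R (a i)).Sub (assemblyRepr R α) := sub_limit hmono hlimR
  have hF := finite_near_blocks hm hfin
  set F := {p : ℤ × ℤ | ∃ u : ℤ × ℤ, u.1 ^ 2 + u.2 ^ 2 ≤ 1 ∧
    coord m p + u ∈ (assemblyRepr R α).dom} with hFdef
  have hdom : ∀ i, (a i).dom ⊆ F := by
    intro i p hp
    obtain ⟨u, hu, hmem⟩ := h.clean hR hm (hprod i).mem (hnonempty i) hp
    exact ⟨u, hu, (hsub i).dom_subset hmem⟩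
  -- Clean mapping confines all stages to the finite set `F`; there pointwise convergence is
  -- uniform, and the limit is attained.
  have hev : ∀ᶠ i in Filter.atTop, ∀ p ∈ F, a i p = α p :=
    (Set.Finite.eventually_all hF).2 fun p _ => hlim p
  obtain ⟨i, hi⟩ := hev.exists
  have : a i = α := by
    funext p
    by_cases hp : p ∈ F
    · exact hi p hp
    · have hnone : ∀ j, a j p = none := by
        intro j
        by_contra hcon
        exact hp (hdom j hcon)
      obtain ⟨j, hj⟩ := (hlim p).exists
      rw [hnone, ← hj, hnone]
  rw [← this]
  exact hprod i

/-- Followed backwards from a representative of the seed of 𝒯, a finite assembly sequence can only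
lose represented tiles, and it never passes through junk. -/
theorem SimulatesUnder.seed_repr (h : 𝒮.SimulatesUnder 𝒯 R) (hR : ValidRepr R) (hm : 0 < m)
    (hτ : 0 < 𝒯.temperature) :
    assemblyRepr R 𝒮.seed ≠ empty ∧ (assemblyRepr R 𝒮.seed).Sub 𝒯.seed := by
  obtain ⟨hne, α, hα, hrepr⟩ := h.exists_repr 𝒯.seed_mem_producible
  have hfin : 𝒮.FinProducible α :=
    h.finProducible hR hm hτ hα (hrepr ▸ hne) (hrepr ▸ 𝒯.seed_finite)
  have key : assemblyRepr R α ≠ empty →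
      assemblyRepr R 𝒮.seed ≠ empty ∧ (assemblyRepr R 𝒮.seed).Sub (assemblyRepr R α) := by
    clear hrepr hα
    induction hfin with
    | refl => exact fun h => ⟨h, Sub.refl _⟩
    | tail hab hs ih =>
      intro hne'
      rcases h.step hR hτ hab hs with h' | ⟨h1, h2, -⟩
      · exact absurd h' hne'
      · exact ⟨(ih h1).1, (ih h1).2.trans h2⟩
  have := key (hrepr ▸ hne)
  rwa [hrepr] at this

/-- Each finite assembly of `𝒯` is represented by a `1`-stable assembly of `𝒮`. -/
theorem SimulatesUnder.exists_stable_repr (h : 𝒮.SimulatesUnder 𝒯 R) (hR : ValidRepr R)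
    (hm : 0 < m) (hτ : 0 < 𝒯.temperature) {α : Assembly 𝒯.tiles} (hα : α ∈ 𝒯.producible)
    (hfin : α.dom.Finite) :
    ∃ β, 𝒮.FinProducible β ∧ assemblyRepr R β = α ∧ β.Stable 1 := by
  obtain ⟨hne, α', hα', hrepr⟩ := h.exists_repr hα
  -- A representative with the fewest tiles is chosen: a cut of strength at most 0 would have a
  -- proper side representing the same `α`.
  have hex : ∃ k, ∃ β, 𝒮.FinProducible β ∧ assemblyRepr R β = α ∧ β.dom.ncard = k :=
    ⟨_, α', h.finProducible hR hm hτ hα' (hrepr ▸ hne) (hrepr ▸ hfin), hrepr, rfl⟩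
  classical
  obtain ⟨β, hβ, hβα, hcard⟩ := Nat.find_spec hex
  refine ⟨β, hβ, hβα, ?_⟩
  intro A hA hlt
  have hd : Detach β (β.restrict A) (β.restrict Aᶜ) := ⟨A, hA, hlt, rfl, rfl⟩
  have h1 : 𝒮.FinProducible (β.restrict A) := hβ.tail (Or.inr ⟨_, hd⟩)
  have h2 : 𝒮.FinProducible (β.restrict Aᶜ) := hβ.tail (Or.inr ⟨_, hd.symm⟩)
  have hsmall : ∀ B, β.IsCut B → (β.restrict B).dom.ncard < β.dom.ncard := by
    intro B hB
    refine Set.ncard_lt_ncard ?_ hβ.dom_finite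
    rw [dom_restrict]
    refine ⟨Set.inter_subset_left, fun hsub => ?_⟩
    obtain ⟨p, hp, hpB⟩ := hB.2
    exact hpB (hsub hp).2
  have hmin : ∀ γ, 𝒮.FinProducible γ → assemblyRepr R γ = α → β.dom.ncard ≤ γ.dom.ncard := by
    intro γ hγ hγα
    rw [hcard]
    exact Nat.find_min' hex ⟨γ, hγ, hγα, rfl⟩
  rcases h.2.1.2 β hβ.mem _ h1.mem _ h2.mem (by rwa [hβα]) hd with hk | hk
  · exact absurd (hmin _ h1 (by rw [← hk.2.1, hβα])) (not_le.2 (hsmall _ hA))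
  · exact absurd (hmin _ h2 (by rw [← hk.2.1, hβα])) (not_le.2 (hsmall _ hA.compl))

end RgTAS

/-! ### Productions of the finger and flagpole system -/

theorem Dir.sum_eq {M : Type*} [AddCommMonoid M] (f : Dir → M) :
    ∑ d : Dir, f d = f .N + (f .E + (f .S + f .W)) := by
  have : (Finset.univ : Finset Dir) = {.N, .E, .S, .W} := rfl
  rw [this, Finset.sum_insert (by decide), Finset.sum_insert (by decide),
    Finset.sum_insert (by decide), Finset.sum_singleton]

namespace FingerFlagpole

open Assembly

/-- The tip of the top finger. -/
def topTip : TileType := ⟨g 10, o, g 11, o⟩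

/-- The tip of the bottom finger. -/
def bottomTip : TileType := ⟨g 14, o, g 13, o⟩

/-- The neighbours on which certain tiles rest are present. -/
def Supported (α : Assembly tiles) : Prop :=
  ∀ p t, α p = some t →
    (t.1 = keystone → α (p + Dir.N.vec) ≠ none ∧ α (p + Dir.S.vec) ≠ none) ∧
    (t.1 = flagpole → α (p + Dir.W.vec) ≠ none) ∧
    (t.1 = flag → α (p + Dir.W.vec) ≠ none) ∧
    (t.1 = topTip → α (p + Dir.N.vec) ≠ none) ∧
    (t.1 = bottomTip → α (p + Dir.S.vec) ≠ none)

theorem side_strength_nonneg (t : tiles) (d : Dir) : 0 ≤ (t.1.side d).strength :=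
  system.strength_nonneg t.1 t.2 d

theorem bond_elim_le (α : Assembly tiles) (p : ℤ × ℤ) (t : tiles) (d : Dir) :
    ((α (p + d.vec)).elim 0 fun s => bondStrength t s d) ≤ (t.1.side d).strength := by
  have := side_strength_nonneg t d
  cases α (p + d.vec) with
  | none => exact this
  | some s =>
    simp only [Option.elim, bondStrength]
    split_ifs
    · exact le_rfl
    · exact this

theorem bond_elim_nonneg (α : Assembly tiles) (p : ℤ × ℤ) (t : tiles) (d : Dir) :
    0 ≤ ((α (p + d.vec)).elim 0 fun s => bondStrength t s d) := by
  have := side_strength_nonneg t d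
  cases α (p + d.vec) with
  | none => exact le_rfl
  | some s =>
    simp only [Option.elim, bondStrength]
    split_ifs
    · exact this
    · exact le_rfl

theorem exists_of_bond_elim_pos {α : Assembly tiles} {p : ℤ × ℤ} {t : tiles} {d : Dir}
    (h : 0 < ((α (p + d.vec)).elim 0 fun s => bondStrength t s d)) :
    ∃ s : tiles, α (p + d.vec) = some s ∧ t.1.side d = s.1.side d.opp := by
  cases hs : α (p + d.vec) with
  | none => rw [hs] at h; exact absurd h (by simp)
  | some s =>
    refine ⟨s, rfl, ?_⟩
    rw [hs] at h
    simp only [Option.elim, bondStrength] at h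
    by_contra hne
    rw [if_neg hne] at h
    exact absurd h (lt_irrefl _)

theorem eq_flagpole_of_west : ∀ s ∈ tiles, g 15 = s.west → s = flagpole := by decide

theorem eq_flag_of_west : ∀ s ∈ tiles, g 16 = s.west → s = flag := by decide

/-- The supports carry the strength needed at temperature 2. Attachment from the east is impossible,
because the east glues of keystone and flagpole match only tiles that already rest on the position
in question. -/
theorem Supported.attach {α β : Assembly tiles} (hα : Supported α) (h : Attach 2 α β) :
    Supported β := by
  have hsub := h.sub
  obtain ⟨p, t, hp, rfl, hsum⟩ := h
  simp only [bond_update] at hsum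
  set β := Function.update α p (some t) with hβ
  have hmono : ∀ q, α q ≠ none → β q ≠ none := fun q hq => hsub.dom_subset hq
  -- A flagpole or flag east of `p` would rest on a tile at `p`, but `p` is still empty.
  have hwest : ∀ s : tiles, α (p + Dir.E.vec) = some s → s.1 ≠ flagpole ∧ s.1 ≠ flag := by
    intro s hs
    have hpe : p + Dir.E.vec + Dir.W.vec = p := by
      ext <;> simp [Dir.vec]
    have := hα _ _ hs
    rw [hpe] at this
    exact ⟨fun h' => this.2.1 h' hp, fun h' => this.2.2.1 h' hp⟩
  intro q s hq
  by_cases hqp : q = p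
  · subst hqp
    rw [hβ, Function.update_self] at hq
    obtain rfl : t = s := by simpa using hq
    rw [Dir.sum_eq] at hsum
    have hN := bond_elim_le α q t .N
    have hE := bond_elim_le α q t .E
    have hS := bond_elim_le α q t .S
    have hW := bond_elim_le α q t .W
    have hE' := bond_elim_nonneg α q t .E
    have zero : ∀ {d : Dir}, α (q + d.vec) = none →
        ((α (q + d.vec)).elim 0 fun s => bondStrength t s d) = 0 := by
      intro d hd
      rw [hd]
      rfl
    have posE : 0 < ((α (q + Dir.E.vec)).elim 0 fun s => bondStrength t s .E) →
        t.1.east ≠ g 15 ∧ t.1.east ≠ g 16 := by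
      intro hpos
      obtain ⟨s, hs, heq⟩ := exists_of_bond_elim_pos hpos
      have hw := hwest s hs
      exact ⟨fun h' => hw.1 (eq_flagpole_of_west _ s.2 (h' ▸ heq)),
        fun h' => hw.2 (eq_flag_of_west _ s.2 (h' ▸ heq))⟩
    -- In each of the six cases the east bond is 0, and without the missing neighbour at most
    -- strength 1 remains.
    refine ⟨fun ht => ⟨fun hn => ?_, fun hn => ?_⟩, fun ht hn => ?_, fun ht hn => ?_,
      fun ht hn => ?_, fun ht hn => ?_⟩ <;>
    · have hn' := zero (by
        by_contra hcon
        exact hmono _ hcon hn)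
      generalize ((α (q + Dir.N.vec)).elim 0 fun s => bondStrength t s .N) = a at *
      generalize ((α (q + Dir.E.vec)).elim 0 fun s => bondStrength t s .E) = b at *
      generalize ((α (q + Dir.S.vec)).elim 0 fun s => bondStrength t s .S) = c at *
      generalize ((α (q + Dir.W.vec)).elim 0 fun s => bondStrength t s .W) = e at *
      simp only [ht] at posE hN hE hS hW
      simp [keystone, flagpole, flag, topTip, bottomTip, TileType.side, g, o] at posE hN hE hS hW
      push_cast at hsum
      linarith
  · rw [hβ, Function.update_of_ne hqp] at hq
    have := hα q s hq
    exact ⟨fun h' => ⟨hmono _ (this.1 h').1, hmono _ (this.1 h').2⟩,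
      fun h' => hmono _ (this.2.1 h'), fun h' => hmono _ (this.2.2.1 h'),
      fun h' => hmono _ (this.2.2.2.1 h'), fun h' => hmono _ (this.2.2.2.2 h')⟩

theorem supported_seed : Supported seed := by
  intro p t h
  unfold seed at h
  split_ifs at h
  obtain rfl : _ = t := by simpa using h
  refine ⟨fun h => ?_, fun h => ?_, fun h => ?_, fun h => ?_, fun h => ?_⟩ <;>
    exact absurd h (by decide)

theorem supported_of_mem_producible {α : Assembly tiles} (h : α ∈ system.producible) :
    Supported α := by
  rcases h with h | ⟨a, h0, hstep, hlim, -⟩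
  · induction h with
    | refl => exact supported_seed
    | tail _ h ih => exact ih.attach h
  · have hall : ∀ i, Supported (a i) := by
      intro i
      induction i with
      | zero => rw [h0]; exact supported_seed
      | succ i ih => exact ih.attach (hstep i)
    intro p t hp
    obtain ⟨i, hi⟩ := (hlim p).exists
    have hsub := sub_limit (fun i => (hstep i).sub) hlim i
    have := hall i p t (hi.trans hp)
    have hmono : ∀ q, a i q ≠ none → α q ≠ none := fun q hq => hsub.dom_subset hq
    exact ⟨fun h' => ⟨hmono _ (this.1 h').1, hmono _ (this.1 h').2⟩,
      fun h' => hmono _ (this.2.1 h'), fun h' => hmono _ (this.2.2.1 h'),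
      fun h' => hmono _ (this.2.2.2.1 h'), fun h' => hmono _ (this.2.2.2.2 h')⟩

/-! ### Construction of the arms, fingers and flag -/

theorem producible_attach {α : Assembly tiles}
    (hα : Relation.ReflTransGen (Attach 2) seed α) {p : ℤ × ℤ} (t : tiles) (hp : α p = none)
    (h : 2 ≤ α.glueSum p t) :
    Relation.ReflTransGen (Attach 2) seed (Function.update α p (some t)) :=
  hα.tail (attach_of_glueSum hp (by exact_mod_cast h))

theorem le_glueSum_of_bond {α : Assembly tiles} {p q : ℤ × ℤ} {t s : tiles} {k : ℤ} (d : Dir)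
    (hq : p + d.vec = q) (hs : α q = some s) (h : bondStrength t s d = k) :
    k ≤ α.glueSum p t := by
  unfold glueSum
  have h1 := Finset.single_le_sum (f := fun d : Dir =>
    ((α (p + d.vec)).elim 0 fun s => bondStrength t s d))
    (fun d _ => bond_elim_nonneg α p t d) (Finset.mem_univ d)
  refine le_trans (le_of_eq ?_) h1
  simp only [hq, hs, Option.elim, h]

theorem producible_attach_strong {α : Assembly tiles}
    (hα : Relation.ReflTransGen (Attach 2) seed α) {p : ℤ × ℤ} (t : tiles) (hp : α p = none)
    {s : tiles} (d : Dir) {q : ℤ × ℤ} (hq : p + d.vec = q) (hs : α q = some s)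
    (h : bondStrength t s d = 2) :
    Relation.ReflTransGen (Attach 2) seed (Function.update α p (some t)) :=
  producible_attach hα t hp (le_glueSum_of_bond d hq hs h)

/-- The two arms, of lengths `k` and `l`, together with the column that joins them. -/
theorem exists_arms (k l : ℕ) : ∃ α : Assembly tiles,
    Relation.ReflTransGen (Attach 2) seed α ∧
    (∀ p : ℤ × ℤ, α p ≠ none → (p.1 = 0 ∧ -3 ≤ p.2 ∧ p.2 ≤ 3) ∨
      (p.2 = 3 ∧ 0 ≤ p.1 ∧ p.1 ≤ k) ∨ (p.2 = -3 ∧ 0 ≤ p.1 ∧ p.1 ≤ l)) ∧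
    (∃ s : tiles, α ((k : ℤ), 3) = some s ∧ s.1.east = g 7) ∧
    (∃ s : tiles, α ((l : ℤ), -3) = some s ∧ s.1.east = g 8) := by
  induction k with
  | zero =>
    induction l with
    | zero =>
      have h0 : Relation.ReflTransGen (Attach 2) seed seed := Relation.ReflTransGen.refl
      have h1 := producible_attach_strong h0 (p := (0, 1)) ⟨⟨g 2, o, g 1, o⟩, by decide⟩
        (by decide) .S (q := (0, 0)) (by decide) rfl (by decide)
      have h2 := producible_attach_strong h1 (p := (0, 2)) ⟨⟨g 3, o, g 2, o⟩, by decide⟩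
        (by decide) .S (q := (0, 1)) (by decide) rfl (by decide)
      have h3 := producible_attach_strong h2 (p := (0, 3)) ⟨⟨o, g 7, g 3, o⟩, by decide⟩
        (by decide) .S (q := (0, 2)) (by decide) rfl (by decide)
      have h4 := producible_attach_strong h3 (p := (0, -1)) ⟨⟨g 4, o, g 5, o⟩, by decide⟩
        (by decide) .N (q := (0, 0)) (by decide) rfl (by decide)
      have h5 := producible_attach_strong h4 (p := (0, -2)) ⟨⟨g 5, o, g 6, o⟩, by decide⟩
        (by decide) .N (q := (0, -1)) (by decide) rfl (by decide)
      have h6 := producible_attach_strong h5 (p := (0, -3)) ⟨⟨g 6, g 8, o, o⟩, by decide⟩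
        (by decide) .N (q := (0, -2)) (by decide) rfl (by decide)
      refine ⟨_, h6, ?_, ⟨_, rfl, rfl⟩, ⟨_, rfl, rfl⟩⟩
      rintro ⟨x, y⟩ hp
      simp only [Function.update_apply, seed] at hp
      split_ifs at hp <;> simp_all
    | succ l ih =>
      obtain ⟨α, hα, hdom, hk, s, hs, hse⟩ := ih
      have hnone : α (((l + 1 : ℕ) : ℤ), -3) = none := by
        by_contra hne
        have := hdom _ hne
        dsimp only at this
        omega
      refine ⟨_, producible_attach_strong hα ⟨⟨o, g 8, o, g 8⟩, by decide⟩ hnone .W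
        (q := ((l : ℤ), -3)) (by simp [Dir.vec]) hs ?_, ?_, ?_, ⟨_, Function.update_self _ _ _, rfl⟩⟩
      · simp [bondStrength, TileType.side, Dir.opp, hse, g]
      · intro p hp
        by_cases hpe : p = (((l + 1 : ℕ) : ℤ), -3)
        · subst hpe
          exact Or.inr (Or.inr ⟨rfl, by positivity, le_rfl⟩)
        · rw [Function.update_of_ne hpe] at hp
          have := hdom p hp
          push_cast
          omega
      · obtain ⟨s', hs', he⟩ := hk
        refine ⟨s', ?_, he⟩
        rw [Function.update_of_ne (by simp)]
        exact hs'
  | succ k ih =>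
    obtain ⟨α, hα, hdom, ⟨s, hs, hse⟩, hl⟩ := ih
    have hnone : α (((k + 1 : ℕ) : ℤ), 3) = none := by
      by_contra hne
      have := hdom _ hne
      dsimp only at this
      omega
    refine ⟨_, producible_attach_strong hα ⟨⟨o, g 7, o, g 7⟩, by decide⟩ hnone .W
      (q := ((k : ℤ), 3)) (by simp [Dir.vec]) hs ?_, ?_, ⟨_, Function.update_self _ _ _, rfl⟩, ?_⟩
    · simp [bondStrength, TileType.side, Dir.opp, hse, g]
    · intro p hp
      by_cases hpe : p = (((k + 1 : ℕ) : ℤ), 3)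
      · subst hpe
        exact Or.inr (Or.inl ⟨rfl, by positivity, le_rfl⟩)
      · rw [Function.update_of_ne hpe] at hp
        have := hdom p hp
        push_cast
        omega
    · obtain ⟨s', hs', he⟩ := hl
      refine ⟨s', ?_, he⟩
      rw [Function.update_of_ne (by simp)]
      exact hs'

/-- The positions of the tiles of the assembly with two arms of length `n` and a flag. -/
def Frame (n : ℤ) (x : ℤ × ℤ) : Prop :=
  (x.1 = 0 ∧ -3 ≤ x.2 ∧ x.2 ≤ 3) ∨ (x.2 = 3 ∧ 0 ≤ x.1 ∧ x.1 ≤ n + 1) ∨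
  (x.2 = -3 ∧ 0 ≤ x.1 ∧ x.1 ≤ n + 1) ∨ (x.1 = n + 1 ∧ -3 ≤ x.2 ∧ x.2 ≤ 3) ∨
  (x.2 = 0 ∧ n + 1 ≤ x.1 ∧ x.1 ≤ n + 3)

/-- The assembly in which two arms of the same length hold a keystone with flagpole and flag. -/
theorem exists_flag_assembly {n : ℕ} (hn : 0 < n) : ∃ α : Assembly tiles, α ∈ system.producible ∧
    (∀ p, α p ≠ none → Frame n p) ∧
    α ((n : ℤ) + 1, 0) = some ⟨keystone, by decide⟩ ∧
    α ((n : ℤ) + 2, 0) = some ⟨flagpole, by decide⟩ ∧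
    α ((n : ℤ) + 3, 0) = some ⟨flag, by decide⟩ ∧
    α ((n : ℤ) + 1, 1) = some ⟨topTip, by decide⟩ ∧
    α ((n : ℤ) + 1, -1) = some ⟨bottomTip, by decide⟩ := by
  obtain ⟨α, h0, hdom, ⟨s, hs, hse⟩, ⟨s', hs', hse'⟩⟩ := exists_arms n n
  have hnone : ∀ x y : ℤ, (n : ℤ) < x → α (x, y) = none := by
    intro x y hx
    by_contra hne
    have := hdom _ hne
    simp only at this
    omega
  have hnone' : α ((n : ℤ), 0) = none := by
    by_contra hne
    have := hdom _ hne
    simp only at this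
    omega
  have h1 := producible_attach_strong h0 (p := ((n : ℤ) + 1, 3)) ⟨⟨o, o, g 9, g 7⟩, by decide⟩
    (hnone _ _ (by omega)) .W (q := ((n : ℤ), 3)) (by simp [Dir.vec]) hs
    (by simp [bondStrength, TileType.side, Dir.opp, hse, g])
  have h2 := producible_attach_strong h1 (p := ((n : ℤ) + 1, 2)) ⟨⟨g 9, o, g 10, o⟩, by decide⟩
    (by simp [hnone]) .N (q := ((n : ℤ) + 1, 3)) (by simp [Dir.vec])
    (by simp; rfl) (by decide)
  have h3 := producible_attach_strong h2 (p := ((n : ℤ) + 1, 1)) ⟨⟨g 10, o, g 11, o⟩, by decide⟩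
    (by simp [hnone]) .N (q := ((n : ℤ) + 1, 2)) (by simp [Dir.vec])
    (by simp; rfl) (by decide)
  have h4 := producible_attach_strong h3 (p := ((n : ℤ) + 1, -3)) ⟨⟨g 12, o, o, g 8⟩, by decide⟩
    (by simp [hnone]) .W (q := ((n : ℤ), -3)) (by simp [Dir.vec])
    (by simp; exact hs')
    (by simp [bondStrength, TileType.side, Dir.opp, hse', g])
  have h5 := producible_attach_strong h4 (p := ((n : ℤ) + 1, -2)) ⟨⟨g 13, o, g 12, o⟩, by decide⟩
    (by simp [hnone]) .S (q := ((n : ℤ) + 1, -3)) (by simp [Dir.vec])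
    (by simp; rfl) (by decide)
  have h6 := producible_attach_strong h5 (p := ((n : ℤ) + 1, -1)) ⟨⟨g 14, o, g 13, o⟩, by decide⟩
    (by simp [hnone]) .S (q := ((n : ℤ) + 1, -2)) (by simp [Dir.vec])
    (by simp; rfl) (by decide)
  -- The only cooperative attachment: strength 1 from each finger tip.
  have h7 := producible_attach h6 (p := ((n : ℤ) + 1, 0)) ⟨keystone, by decide⟩
    (by simp [hnone]) (by
      simp [glueSum, Dir.sum_eq, Dir.vec, hnone, hnone']
      decide)
  have h8 := producible_attach_strong h7 (p := ((n : ℤ) + 2, 0)) ⟨flagpole, by decide⟩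
    (by simp [hnone]) .W (q := ((n : ℤ) + 1, 0))
    (by simp [Dir.vec]; ring)
    (by simp; rfl) (by decide)
  have h9 := producible_attach_strong h8 (p := ((n : ℤ) + 3, 0)) ⟨flag, by decide⟩
    (by simp [hnone]) .W (q := ((n : ℤ) + 2, 0))
    (by simp [Dir.vec]; ring)
    (by simp; rfl) (by decide)
  refine ⟨_, Or.inl h9, ?_, ?_, ?_, ?_, ?_, ?_⟩
  · rintro ⟨x, y⟩ hp
    simp only [Function.update_apply, Prod.mk.injEq] at hp
    unfold Frame
    simp only
    split_ifs at hp
    case neg => have := hdom _ hp; simp only at this; omega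
    all_goals omega
  all_goals
    simp only [Function.update_apply, Prod.mk.injEq]
    norm_num
    try rfl

theorem Frame.finite (n : ℕ) : {x | Frame n x}.Finite := by
  refine ((Set.finite_Icc (0 : ℤ) (n + 3)).prod (Set.finite_Icc (-3 : ℤ) 3)).subset ?_
  rintro ⟨x, y⟩ h
  simp only [Frame, Set.mem_ofPred_eq] at h
  simp only [Set.mem_prod, Set.mem_Icc]
  omega

end FingerFlagpole

/-! ### Growth by placements of coloured tiles -/

/-- The three parts of the plane between which the tiles of a growing assembly are divided. -/
inductive Side
  | left | top | bottom
  deriving DecidableEq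

namespace Side

instance : Finite Side :=
  Finite.of_injective (fun s : Side => (match s with | left => 0 | top => 1 | bottom => 2 : Fin 3))
    (by intro a b h; cases a <;> cases b <;> simp_all)

/-- Top and bottom ignore each other. -/
def Sees (a b : Side) : Prop := a = b ∨ a = left ∨ b = left

instance (a b : Side) : Decidable (a.Sees b) := inferInstanceAs (Decidable (_ ∨ _ ∨ _))

/-- Exchange of top and bottom. -/
def other : Side → Side
  | left => left
  | top => bottom
  | bottom => top

theorem eq_other {a b : Side} (ha : a ≠ left) (hb : b ≠ left) (h : a ≠ b) : b = a.other := by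
  cases a <;> cases b <;> simp_all [other]

theorem sees_iff {a b : Side} (ha : a ≠ left) : a.Sees b ↔ b ≠ a.other := by
  cases a <;> cases b <;> simp_all [other, Sees]

end Side

/-- A tile together with its position and its side. -/
abbrev Placement (S : Finset TileType) := (ℤ × ℤ) × S × Side

namespace Assembly

variable {S : Finset TileType}

/-- The assembly that arises from `σ` by the given placements, the last of which is the head of
the list. -/
def build (σ : Assembly S) : List (Placement S) → Assembly S
  | [] => σ
  | e :: l => Function.update (build σ l) e.1 (some e.2.1)

theorem build_eq_none_iff {σ : Assembly S} {l : List (Placement S)} {q : ℤ × ℤ} :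
    build σ l q = none ↔ σ q = none ∧ ∀ e ∈ l, e.1 ≠ q := by
  induction l with
  | nil => simp [build]
  | cons e l ih =>
    by_cases h : q = e.1
    · subst h
      simp [build]
    · simp [build, Function.update_of_ne h, ih, Ne.symm h]

/-- The placements are at different positions, all outside of `σ`. -/
def Fresh (σ : Assembly S) (l : List (Placement S)) : Prop :=
  (l.map Prod.fst).Nodup ∧ ∀ e ∈ l, σ e.1 = none

theorem fresh_cons {σ : Assembly S} {e : Placement S} {l : List (Placement S)} :
    Fresh σ (e :: l) ↔ Fresh σ l ∧ build σ l e.1 = none := by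
  rw [build_eq_none_iff]
  simp only [Fresh, List.map_cons, List.nodup_cons, List.mem_map, List.forall_mem_cons]
  constructor
  · rintro ⟨⟨h1, h2⟩, h3, h4⟩
    exact ⟨⟨h2, h4⟩, h3, fun f hf hfe => h1 ⟨f, hf, hfe⟩⟩
  · rintro ⟨⟨h2, h4⟩, h3, h1⟩
    exact ⟨⟨fun ⟨f, hf, hfe⟩ => h1 f hf hfe, h2⟩, h3, h4⟩

theorem Fresh.filter {σ : Assembly S} {l : List (Placement S)} (h : Fresh σ l)
    (P : Placement S → Bool) : Fresh σ (l.filter P) :=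
  ⟨h.1.sublist (List.filter_sublist.map _), fun e he => h.2 e (List.mem_of_mem_filter he)⟩

theorem build_eq_some_iff {σ : Assembly S} {l : List (Placement S)} (h : Fresh σ l)
    {q : ℤ × ℤ} {s : S} :
    build σ l q = some s ↔ σ q = some s ∨ ∃ e ∈ l, e.1 = q ∧ e.2.1 = s := by
  induction l with
  | nil => simp [build]
  | cons e l ih =>
    rw [fresh_cons] at h
    have hnone := build_eq_none_iff.1 h.2
    by_cases hq : q = e.1
    · subst hq
      simp only [build, Function.update_self, hnone.1, List.mem_cons, exists_eq_or_imp]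
      simp only [Option.some.injEq, reduceCtorEq, true_and, false_or]
      constructor
      · exact fun h => Or.inl h
      · rintro (h | ⟨f, hf, hfe, -⟩)
        · exact h
        · exact absurd hfe (hnone.2 f hf)
    · simp only [build, Function.update_of_ne hq, ih h.1, List.mem_cons, exists_eq_or_imp,
        Ne.symm hq, false_and, false_or]

theorem build_filter_eq {σ : Assembly S} {l : List (Placement S)} {P : Placement S → Bool}
    {q : ℤ × ℤ} (h : ∀ e ∈ l, e.1 = q → P e = true) : build σ (l.filter P) q = build σ l q := by
  induction l with
  | nil => rfl
  | cons e l ih =>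
    rw [List.forall_mem_cons] at h
    have ih := ih h.2
    by_cases hP : P e = true
    · rw [List.filter_cons_of_pos hP]
      by_cases hq : q = e.1
      · subst hq
        simp [build]
      · simp only [build, Function.update_of_ne hq, ih]
    · rw [List.filter_cons_of_neg hP, ih]
      have hq : q ≠ e.1 := fun hq => hP (h.1 hq.symm)
      simp only [build, Function.update_of_ne hq]

theorem build_filter_eq_none {σ : Assembly S} {l : List (Placement S)} {P : Placement S → Bool}
    {q : ℤ × ℤ} (hσ : σ q = none) (h : ∀ e ∈ l, e.1 = q → P e = false) :
    build σ (l.filter P) q = none := by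
  rw [build_eq_none_iff]
  refine ⟨hσ, fun e he hq => ?_⟩
  rw [List.mem_filter] at he
  rw [h e he.1 hq] at he
  exact absurd he.2 (by simp)

/-- The list of placements, of which the last one is the head, is such that each placement
satisfies `Z` and binds with strength at least `1` to those earlier ones that its side sees. -/
def Grown (σ : Assembly S) (Z : Placement S → Prop) : List (Placement S) → Prop
  | [] => True
  | e :: l => Grown σ Z l ∧ build σ l e.1 = none ∧ Z e ∧
      1 ≤ (build σ (l.filter fun f => e.2.2.Sees f.2.2)).glueSum e.1 e.2.1

theorem Grown.fresh {σ : Assembly S} {Z : Placement S → Prop} {l : List (Placement S)}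
    (h : Grown σ Z l) : Fresh σ l := by
  induction l with
  | nil => exact ⟨by simp, by simp⟩
  | cons e l ih => exact fresh_cons.2 ⟨ih h.1, h.2.1⟩

theorem Grown.forall_mem {σ : Assembly S} {Z : Placement S → Prop} {l : List (Placement S)}
    (h : Grown σ Z l) : ∀ e ∈ l, Z e := by
  induction l with
  | nil => simp
  | cons e l ih => exact List.forall_mem_cons.2 ⟨h.2.2.1, ih h.1⟩

theorem Grown.of_append {σ : Assembly S} {Z : Placement S → Prop} {l l' : List (Placement S)}
    (h : Grown σ Z (l ++ l')) : Grown σ Z l' := by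
  induction l with
  | nil => exact h
  | cons e l ih => exact ih h.1

theorem Grown.build_sub {σ β : Assembly S} {Z : Placement S → Prop} {l : List (Placement S)}
    (h : Grown σ Z l) (hσ : σ.Sub β) (hZ : ∀ e, Z e → β e.1 = some e.2.1) :
    (build σ l).Sub β := by
  intro q s hq
  rcases (build_eq_some_iff h.fresh).1 hq with hq | ⟨e, he, rfl, rfl⟩
  · exact hσ q s hq
  · exact hZ e (h.forall_mem e he)

theorem Fresh.eq_of_pos_eq {σ : Assembly S} {l : List (Placement S)} (h : Fresh σ l)
    {e f : Placement S} (he : e ∈ l) (hf : f ∈ l) (hef : e.1 = f.1) : e = f :=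
  List.inj_on_of_nodup_map h.1 he hf hef

/-- Translates the bonds within `β` supplied by stability into the strength of an attachment to the
part grown so far. -/
theorem glueSum_of_sub {α β : Assembly S} (h : α.Sub β) {p : ℤ × ℤ} {t : S} (hp : β p = some t) :
    α.glueSum p t = ∑ d : Dir, open Classical in if p + d.vec ∈ α.dom then β.bond p d else 0 := by
  unfold glueSum
  refine Finset.sum_congr rfl fun d _ => ?_
  cases hd : α (p + d.vec) with
  | none =>
    rw [if_neg (by simp [dom, hd])]
    rfl
  | some s =>
    rw [if_pos (mem_dom.2 ⟨s, hd⟩)]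
    unfold bond
    rw [hp, h _ _ hd]
    rfl

/-- A placement that is possible after the placements `r` is possible after the placements `u`
if the neighbours that it sees are the same. -/
theorem glueSum_transfer {σ : Assembly S} {r u : List (Placement S)} {p : ℤ × ℤ} {t : S}
    {s : Side} (hr : Fresh σ r) (hu : Fresh σ u) (hnone : build σ r p = none)
    (hsum : 1 ≤ (build σ (r.filter fun f => s.Sees f.2.2)).glueSum p t)
    (h0 : ∀ f ∈ u, f.1 = p → f ∈ r)
    (h1 : ∀ f ∈ u, ∀ d : Dir, f.1 = p + d.vec → f ∈ r ∧ s.Sees f.2.2)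
    (h2 : ∀ f ∈ r, ∀ d : Dir, f.1 = p + d.vec → s.Sees f.2.2 → f ∈ u) :
    build σ u p = none ∧ 1 ≤ (build σ u).glueSum p t := by
  rw [build_eq_none_iff] at hnone
  refine ⟨build_eq_none_iff.2 ⟨hnone.1, fun f hf hfp => hnone.2 f (h0 f hf hfp) hfp⟩, ?_⟩
  refine hsum.trans_eq (glueSum_congr t fun d => ?_)
  ext x
  rw [build_eq_some_iff (hr.filter _), build_eq_some_iff hu]
  refine or_congr Iff.rfl (exists_congr fun f => ?_)
  simp only [List.mem_filter, decide_eq_true_eq]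
  constructor
  · rintro ⟨⟨hf, hs⟩, hq, hx⟩
    exact ⟨h2 f hf d hq hs, hq, hx⟩
  · rintro ⟨hf, hq, hx⟩
    exact ⟨h1 f hf d hq, hq, hx⟩

end Assembly

/-! ### Zones and windows -/

namespace FingerFlagpole

open Assembly Block

variable {S : Finset TileType} {m : ℕ}

/-- A region that contains all blocks in or next to the frame. -/
def Near (n : ℤ) (x : ℤ × ℤ) : Prop :=
  -4 ≤ x.2 ∧ x.2 ≤ 4 ∧ x.1 ≤ n + 4 ∧
    (x.1 ≤ 1 ∨ ((x.2 ≤ -2 ∨ 2 ≤ x.2) ∧ x.1 ≤ n + 2) ∨ n ≤ x.1)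

/-- The blocks in which tiles of a given side are expected before the keystone is in place. -/
def Zone (n : ℤ) : Side → ℤ × ℤ → Prop
  | .left, x => x.1 ≤ 1
  | .top, x => 2 ≤ x.1 ∧ (1 ≤ x.2 ∨ x.1 = n + 1 ∧ x.2 = 0)
  | .bottom, x => 2 ≤ x.1 ∧ (x.2 ≤ -1 ∨ x.1 = n + 1 ∧ x.2 = 0)

/-- Two blocks are equal or share an edge. -/
def Touch (x y : ℤ × ℤ) : Prop :=
  (y.1 = x.1 ∧ x.2 - 1 ≤ y.2 ∧ y.2 ≤ x.2 + 1) ∨ (y.2 = x.2 ∧ x.1 - 1 ≤ y.1 ∧ y.1 ≤ x.1 + 1)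

theorem touch_of_sq_le {x u : ℤ × ℤ} (hu : u.1 ^ 2 + u.2 ^ 2 ≤ 1) : Touch x (x + u) := by
  obtain ⟨a, b⟩ := u
  have h1 : -1 ≤ a ∧ a ≤ 1 := ⟨by nlinarith [sq_nonneg b], by nlinarith [sq_nonneg b]⟩
  have h2 : -1 ≤ b ∧ b ≤ 1 := ⟨by nlinarith [sq_nonneg a], by nlinarith [sq_nonneg a]⟩
  have h3 : a = 0 ∨ b = 0 := by
    by_contra hcon
    push Not at hcon
    have := Int.one_le_abs hcon.1
    have := Int.one_le_abs hcon.2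
    have h4 := sq_abs a
    have h5 := sq_abs b
    simp only at hu
    nlinarith
  simp only [Touch, Prod.fst_add, Prod.snd_add]
  omega

theorem Frame.near {n : ℤ} (hn : 0 ≤ n) {x y : ℤ × ℤ} (h : Touch x y) (hy : Frame n y) :
    Near n x := by
  unfold Touch at h
  unfold Frame at hy
  unfold Near
  omega

theorem touch_coord (hm : 0 < m) (p : ℤ × ℤ) (d : Dir) :
    Touch (coord m p) (coord m (p + d.vec)) := by
  have hm' : (0 : ℤ) < m := by omega
  have key : ∀ a : ℤ, a / m ≤ (a + 1) / m ∧ (a + 1) / m ≤ a / m + 1 := by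
    intro a
    refine ⟨Int.ediv_le_ediv hm' (by omega), ?_⟩
    have h : (a + 1) / (m : ℤ) ≤ (a + m) / m := Int.ediv_le_ediv hm' (by omega)
    rwa [Int.add_ediv_of_dvd_right (dvd_refl _), Int.ediv_self hm'.ne'] at h
  have key' : ∀ a : ℤ, a / m - 1 ≤ (a + -1) / m ∧ (a + -1) / m ≤ a / m := by
    intro a
    have := key (a + -1)
    rw [neg_add_cancel_right] at this
    omega
  have k1 := key p.1
  have k2 := key p.2
  have k3 := key' p.1
  have k4 := key' p.2
  cases d <;> simp only [Touch, coord, Dir.vec, Prod.fst_add, Prod.snd_add, add_zero, true_and] <;> omega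

/-- The placement agrees with `β` and lies in the zone of its side. -/
def Placed (m : ℕ) (n : ℤ) (β : Assembly S) (e : Placement S) : Prop :=
  Near n (coord m e.1) ∧ Zone n e.2.2 (coord m e.1) ∧ β e.1 = some e.2.1

/-- The tile `t` at `p`, seen as a tile of side `s`, can attach after the placements `l`, next to a
tile of this side, but lies outside of the zone. -/
def Escapes (m : ℕ) (n : ℤ) (σ β : Assembly S) (l : List (Placement S)) (p : ℤ × ℤ) (t : S)
    (s : Side) : Prop :=
  s ≠ .left ∧ β p = some t ∧ build σ l p = none ∧ ¬ Zone n s (coord m p) ∧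
  2 ≤ (coord m p).1 ∧ (∃ e ∈ l, e.2.2 = s ∧ ∃ d : Dir, e.1 = p + d.vec) ∧
  1 ≤ (build σ (l.filter fun f => s.Sees f.2.2)).glueSum p t

theorem Zone.eq_left {n : ℤ} {s : Side} {x : ℤ × ℤ} (h : Zone n s x) (hx : x.1 ≤ 1) :
    s = .left := by
  cases s <;> simp only [Zone] at h <;> first | rfl | omega

theorem Zone.le_one {n : ℤ} {x : ℤ × ℤ} (h : Zone n .left x) : x.1 ≤ 1 := h

/-- A stable assembly that contains a tile in the block of the flag can be grown until a tile
escapes. -/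
theorem grown_extend_or_escapes (hm : 0 < m) {n : ℤ} (hn : 10 ≤ n) {σ β : Assembly S}
    (hσ : σ.Sub β) (hσne : σ.dom.Nonempty) (hσleft : ∀ p ∈ σ.dom, (coord m p).1 ≤ 1)
    (hst : β.Stable 1) (hfin : β.dom.Finite) (hnear : ∀ p ∈ β.dom, Near n (coord m p))
    (hflag : ∃ p ∈ β.dom, coord m p = (n + 3, 0)) {l : List (Placement S)}
    (hl : Grown σ (Placed m n β) l) :
    (∃ e, Grown σ (Placed m n β) (e :: l)) ∨ ∃ p t s, Escapes m n σ β l p t s := by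
  have hsub : (build σ l).Sub β := hl.build_sub hσ fun e he => he.2.2
  have hfresh := hl.fresh
  have hσnone : ∀ q : ℤ × ℤ, ¬ (coord m q).1 ≤ 1 → σ q = none := by
    intro q hq
    by_contra hne
    exact hq (hσleft q hne)
  -- The growth has not exhausted `β`: the block of the flag is to the right of the seed and in no
  -- zone.
  obtain ⟨p, ⟨hpβ, hpA⟩, hsum⟩ := hst.exists_bound_tile hfin (build σ l).dom (by
      obtain ⟨q, hq⟩ := hσne
      refine ⟨q, hσ.dom_subset hq, fun hnone => ?_⟩
      exact hq (build_eq_none_iff.1 hnone).1) (by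
      obtain ⟨q, hq, hqf⟩ := hflag
      refine ⟨q, hq, fun hne => hne (build_eq_none_iff.2 ⟨hσnone q ?_, fun e he heq => ?_⟩)⟩
      · rw [hqf]
        simp only
        omega
      · have h := (hl.forall_mem e he).2.1
        rw [heq, hqf] at h
        cases hs : e.2.2 <;> rw [hs] at h <;> simp only [Zone] at h <;> omega)
  obtain ⟨t, ht⟩ := mem_dom.1 hpβ
  have hnone : build σ l p = none := by
    by_contra hne
    exact hpA hne
  rw [← glueSum_of_sub hsub ht] at hsum
  have hpn := hnear p hpβ
  have place : ∀ s, Zone n s (coord m p) →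
      1 ≤ (build σ (l.filter fun f => s.Sees f.2.2)).glueSum p t →
      ∃ e, Grown σ (Placed m n β) (e :: l) :=
    fun s hz hs => ⟨(p, t, s), hl, hnone, ⟨hpn, hz, ht⟩, hs⟩
  by_cases hleft : (coord m p).1 ≤ 1
  · left
    refine place .left hleft ?_
    rw [List.filter_eq_self.2 fun f _ => by simp [Side.Sees]]
    exact hsum
  by_cases hwin : ∃ d : Dir, (coord m (p + d.vec)).1 ≤ 1
  · left
    have hx : (coord m p).1 = 2 := by
      obtain ⟨d, hd⟩ := hwin
      have := touch_coord hm p d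
      unfold Touch at this
      omega
    -- In block column 2 only the two arms are near the frame, in rows too far apart to touch. So
    -- all neighbours are on the left or on the side of `p`, and nothing is lost by ignoring the
    -- other side.
    have hy : (coord m p).2 ≤ -2 ∨ 2 ≤ (coord m p).2 := by
      unfold Near at hpn
      omega
    have key : ∀ s : Side, (∀ e ∈ l, ∀ d : Dir, e.1 = p + d.vec → s.Sees e.2.2) →
        1 ≤ (build σ (l.filter fun f => s.Sees f.2.2)).glueSum p t := by
      intro s hs
      refine hsum.trans_eq (glueSum_congr t fun d => (build_filter_eq ?_).symm)
      intro e he heq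
      simpa using hs e he d heq
    rcases hy with hy | hy
    · refine place .bottom (by simp only [Zone]; omega) (key _ fun e he d heq => ?_)
      have ht := touch_coord hm p d
      have hz := (hl.forall_mem e he).2.1
      rw [heq] at hz
      cases hs : e.2.2 <;> rw [hs] at hz <;> simp only [Zone, Touch] at hz ht <;>
        first | omega | simp [Side.Sees]
    · refine place .top (by simp only [Zone]; omega) (key _ fun e he d heq => ?_)
      have ht := touch_coord hm p d
      have hz := (hl.forall_mem e he).2.1
      rw [heq] at hz
      cases hs : e.2.2 <;> rw [hs] at hz <;> simp only [Zone, Touch] at hz ht <;>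
        first | omega | simp [Side.Sees]
  push Not at hwin
  have hside : ∀ e ∈ l, ∀ d : Dir, e.1 = p + d.vec → e.2.2 ≠ .left := by
    intro e he d heq hs
    have hz := (hl.forall_mem e he).2.1
    rw [hs, heq] at hz
    exact absurd hz.le_one (not_le.2 (hwin d))
  -- Away from the window each neighbour is either top or bottom, so the strength splits into two
  -- integers, one of which must be at least 1.
  have hsplit : (build σ l).glueSum p t =
      (build σ (l.filter fun f => Side.top.Sees f.2.2)).glueSum p t +
      (build σ (l.filter fun f => Side.bottom.Sees f.2.2)).glueSum p t := by
    unfold glueSum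
    rw [← Finset.sum_add_distrib]
    refine Finset.sum_congr rfl fun d _ => ?_
    have hσd := hσnone (p + d.vec) (not_le.2 (hwin d))
    by_cases hex : ∃ e ∈ l, e.1 = p + d.vec
    · obtain ⟨e, he, heq⟩ := hex
      have huniq : ∀ f ∈ l, f.1 = p + d.vec → f = e := fun f hf hfeq =>
        hfresh.eq_of_pos_eq hf he (hfeq.trans heq.symm)
      cases hs : e.2.2 with
      | left => exact absurd hs (hside e he d heq)
      | top =>
        rw [build_filter_eq (fun f hf hfeq => by rw [huniq f hf hfeq, hs]; rfl),
          build_filter_eq_none hσd (fun f hf hfeq => by rw [huniq f hf hfeq, hs]; rfl)]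
        simp
      | bottom =>
        rw [build_filter_eq_none hσd (fun f hf hfeq => by rw [huniq f hf hfeq, hs]; rfl),
          build_filter_eq (fun f hf hfeq => by rw [huniq f hf hfeq, hs]; rfl)]
        simp
    · push Not at hex
      rw [build_filter_eq_none hσd (fun f hf hfeq => absurd hfeq (hex f hf)),
        build_filter_eq_none hσd (fun f hf hfeq => absurd hfeq (hex f hf)),
        build_eq_none_iff.2 ⟨hσd, hex⟩]
      simp
  obtain ⟨s, hs, hsum'⟩ : ∃ s, s ≠ Side.left ∧
      1 ≤ (build σ (l.filter fun f => s.Sees f.2.2)).glueSum p t := by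
    by_cases h : 1 ≤ (build σ (l.filter fun f => Side.top.Sees f.2.2)).glueSum p t
    · exact ⟨.top, by decide, h⟩
    · exact ⟨.bottom, by decide, by omega⟩
  by_cases hz : Zone n s (coord m p)
  · exact Or.inl (place s hz hsum')
  refine Or.inr ⟨p, t, s, hs, ht, hnone, hz, by omega, ?_, hsum'⟩
  -- With no neighbour of side `s`, the side `s` would see nothing and contribute 0.
  by_contra hcon
  push Not at hcon
  have : (build σ (l.filter fun f => s.Sees f.2.2)).glueSum p t = 0 := by
    unfold glueSum
    refine Finset.sum_eq_zero fun d _ => ?_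
    rw [build_filter_eq_none (hσnone (p + d.vec) (not_le.2 (hwin d)))]
    · rfl
    · intro e he heq
      have h1 := hside e he d heq
      have h2 : e.2.2 ≠ s := fun h => hcon e he h d heq
      rw [decide_eq_false_iff_not, Side.sees_iff hs, not_not]
      exact Side.eq_other hs h1 (Ne.symm h2)
  omega

/-- Growth without an escape would place arbitrarily many tiles at different positions of the finite
`β`. -/
theorem exists_escapes (hm : 0 < m) {n : ℤ} (hn : 10 ≤ n) {σ β : Assembly S}
    (hσ : σ.Sub β) (hσne : σ.dom.Nonempty) (hσleft : ∀ p ∈ σ.dom, (coord m p).1 ≤ 1)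
    (hst : β.Stable 1) (hfin : β.dom.Finite) (hnear : ∀ p ∈ β.dom, Near n (coord m p))
    (hflag : ∃ p ∈ β.dom, coord m p = (n + 3, 0)) :
    ∃ l, Grown σ (Placed m n β) l ∧ ∃ p t s, Escapes m n σ β l p t s := by
  by_contra hcon
  push Not at hcon
  have hlong : ∀ k : ℕ, ∃ l, Grown σ (Placed m n β) l ∧ l.length = k := by
    intro k
    induction k with
    | zero => exact ⟨[], trivial, rfl⟩
    | succ k ih =>
      obtain ⟨l, hl, hlen⟩ := ih
      rcases grown_extend_or_escapes hm hn hσ hσne hσleft hst hfin hnear hflag hl with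
        ⟨e, he⟩ | ⟨p, t, s, h⟩
      · exact ⟨e :: l, he, by simp [hlen]⟩
      · exact absurd h (hcon l hl p t s)
  obtain ⟨l, hl, hlen⟩ := hlong (hfin.toFinset.card + 1)
  have h1 : (l.map Prod.fst).toFinset ⊆ hfin.toFinset := by
    intro q hq
    obtain ⟨e, he, rfl⟩ := List.mem_map.1 (List.mem_toFinset.1 hq)
    exact hfin.mem_toFinset.2 (mem_dom.2 ⟨_, (hl.forall_mem e he).2.2⟩)
  have h2 := Finset.card_le_card h1
  rw [List.toFinset_card_of_nodup hl.fresh.1, List.length_map] at h2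
  omega

/-- The two columns on both sides of the line that separates the left from the other sides. -/
def Strip (m : ℕ) (p : ℤ × ℤ) : Prop :=
  (p.1 = 2 * m - 1 ∨ p.1 = 2 * m) ∧ -4 * (m : ℤ) ≤ p.2 ∧ p.2 < 5 * m

instance : DecidablePred (Strip m) := fun _ => inferInstanceAs (Decidable (_ ∧ _ ∧ _))

theorem strip_finite (m : ℕ) : {p | Strip m p}.Finite := by
  refine ((Set.finite_Icc (2 * (m : ℤ) - 1) (2 * m)).prod
    (Set.finite_Icc (-4 * (m : ℤ)) (5 * m))).subset ?_
  rintro ⟨x, y⟩ h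
  simp only [Strip, Set.mem_ofPred_eq] at h
  simp only [Set.mem_prod, Set.mem_Icc]
  omega

/-- All interaction between the left and the other sides passes through the strip. Its height comes
from the block rows from -4 to 4 in `Near`. -/
theorem strip_of_adjacent (hm : 0 < m) {n : ℤ} {p q : ℤ × ℤ} {d : Dir} (hpq : q = p + d.vec)
    (hp : (coord m p).1 ≤ 1) (hq : 2 ≤ (coord m q).1) (hnear : Near n (coord m q)) :
    Strip m p ∧ Strip m q := by
  have hm' : (0 : ℤ) < m := by omega
  have h1 : p.1 < 2 * m := by
    have : p.1 / (m : ℤ) < 2 := by simp only [coord] at hp; omega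
    exact (Int.ediv_lt_iff_lt_mul hm').1 this
  have h2 : 2 * (m : ℤ) ≤ q.1 := (Int.le_ediv_iff_mul_le hm').1 hq
  have h3 : -4 * (m : ℤ) ≤ q.2 := (Int.le_ediv_iff_mul_le hm').1 hnear.1
  have h4 : q.2 < 5 * m := by
    have : q.2 / (m : ℤ) < 5 := by have := hnear.2.1; simp only [coord] at this; omega
    exact (Int.ediv_lt_iff_lt_mul hm').1 this
  subst hpq
  unfold Strip
  cases d <;> simp only [Dir.vec, Prod.fst_add, Prod.snd_add, add_zero] at * <;> omega

/-- Right of the window, opposite sides can meet only about row 0, hence close to the keystone of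
each world; the two keystones are at least 10 columns apart. -/
theorem not_touch_of_far {n n' : ℤ} (hn : 10 ≤ n) (hn' : 10 ≤ n')
    (hfar : n + 10 ≤ n' ∨ n' + 10 ≤ n) {s : Side} (hs : s ≠ .left) {x y : ℤ × ℤ}
    (hx : Near n x) (hy : Near n' y) (hxs : Zone n s x) (hys : Zone n' s.other y) :
    ¬ Touch x y := by
  intro h
  unfold Near at hx hy
  cases s
  · exact hs rfl
  all_goals
    simp only [Zone, Side.other, Touch] at *
    omega

/-! ### Splicing -/

/-- Two lists that agree where they overlap can be merged. -/
theorem exists_merge {E : Type*} (P Q : E → Bool) (l l' : List E)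
    (hl : ∀ e ∈ l, P e = true) (hl' : ∀ e ∈ l', Q e = true) (h : l.filter Q = l'.filter P) :
    ∃ w : List E, w.filter P = l ∧ w.filter Q = l' := by
  induction l generalizing l' with
  | nil =>
    exact ⟨l', h.symm, List.filter_eq_self.2 hl'⟩
  | cons a l ih =>
    rw [List.forall_mem_cons] at hl
    by_cases ha : Q a = true
    · rw [List.filter_cons_of_pos ha] at h
      obtain ⟨l₁, l₂, rfl, h1, h2, h3⟩ := List.filter_eq_cons_iff.1 h.symm
      obtain ⟨w, hw, hw'⟩ := ih l₂ hl.2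
        (fun e he => hl' e (List.mem_append_right _ (List.mem_cons_of_mem _ he))) h3.symm
      refine ⟨l₁ ++ a :: w, ?_, ?_⟩
      · rw [List.filter_append, List.filter_cons_of_pos h2, hw, List.filter_eq_nil_iff.2 h1]
        rfl
      · rw [List.filter_append, List.filter_cons_of_pos ha, hw',
          List.filter_eq_self.2 fun e he => hl' e (List.mem_append_left _ he)]
    · rw [List.filter_cons_of_neg ha] at h
      obtain ⟨w, hw, hw'⟩ := ih l' hl.2 hl' h
      refine ⟨a :: w, ?_, ?_⟩
      · rw [List.filter_cons_of_pos hl.1, hw]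
      · rw [List.filter_cons_of_neg ha, hw']

/-- Finds, in the original world, the moment at which a placement of the merged list was made: the
relevant earlier placements are the same. -/
theorem exists_suffix_of_filter {E : Type*} {P : E → Bool} {l v u : List E} {e : E}
    (he : P e = true) (h : (v ++ e :: u).filter P = l.filter P) :
    ∃ a r, l = a ++ e :: r ∧ r.filter P = u.filter P := by
  rw [List.filter_append, List.filter_cons_of_pos he] at h
  obtain ⟨l₁, l₂, rfl, -, h2⟩ := List.filter_eq_append_iff.1 h.symm
  obtain ⟨l₃, l₄, rfl, -, -, h4⟩ := List.filter_eq_cons_iff.1 h2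
  exact ⟨l₁ ++ l₃, l₄, by simp, h4⟩

/-- The placements of a world that are used when the side `o` is taken from elsewhere. -/
def keepsSide (m : ℕ) (o : Side) (e : Placement S) : Bool := e.2.2 ≠ o ∨ Strip m e.1

/-- The placements of a world from which the side `o` is taken. -/
def givesSide (m : ℕ) (o : Side) (e : Placement S) : Bool := e.2.2 = o ∨ Strip m e.1

/-- Two growths that look the same at the window can be spliced: the side opposite to `s` is taken
from the second one, everything else from the first one. -/
theorem reaches_of_splice (hm : 0 < m) {n n' : ℤ} (hn : 10 ≤ n) (hn' : 10 ≤ n')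
    (hfar : n + 10 ≤ n' ∨ n' + 10 ≤ n) {σ β β' : Assembly S} {s : Side} (hs : s ≠ .left)
    {l l' w : List (Placement S)} (hl : Grown σ (Placed m n β) l)
    (hl' : Grown σ (Placed m n' β') l')
    (hw : w.filter (keepsSide m s.other) = l.filter (keepsSide m s.other))
    (hw' : w.filter (givesSide m s.other) = l'.filter (givesSide m s.other)) :
    Fresh σ w ∧ Relation.ReflTransGen (Attach 1) σ (build σ w) := by
  have ho : s.other ≠ .left := by cases s <;> simp_all [Side.other]
  have hoo : s.other.other = s := by cases s <;> rfl
  have memw : ∀ f ∈ w, f.2.2 ≠ s.other ∨ Strip m f.1 → f ∈ l := by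
    intro f hf h
    have : f ∈ l.filter (keepsSide m s.other) := by
      rw [← hw, List.mem_filter]
      exact ⟨hf, by simpa [keepsSide] using h⟩
    exact List.mem_of_mem_filter this
  have memw' : ∀ f ∈ w, f.2.2 = s.other ∨ Strip m f.1 → f ∈ l' := by
    intro f hf h
    have : f ∈ l'.filter (givesSide m s.other) := by
      rw [← hw', List.mem_filter]
      exact ⟨hf, by simpa [givesSide] using h⟩
    exact List.mem_of_mem_filter this
  have eq_s : ∀ a : Side, a ≠ s.other → a ≠ .left → a = s := by
    intro a h1 h2
    cases a <;> cases s <;> simp_all [Side.other]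
  have right : ∀ {k : ℤ} {γ : Assembly S} {f : Placement S}, Placed m k γ f → f.2.2 ≠ .left →
      2 ≤ (coord m f.1).1 := by
    intro k γ f hf hne
    have := hf.2.1
    by_contra hcon
    exact hne (this.eq_left (by omega))
  have left : ∀ {k : ℤ} {γ : Assembly S} {f : Placement S}, Placed m k γ f → f.2.2 = .left →
      (coord m f.1).1 ≤ 1 := by
    intro k γ f hf he
    have := hf.2.1
    rw [he] at this
    exact this.le_one
  have apart : ∀ e f : Placement S, Placed m n β e → e.2.2 = s → Placed m n' β' f →
      f.2.2 = s.other → ¬ Touch (coord m e.1) (coord m f.1) := by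
    intro e f he hes hf hfs
    exact not_touch_of_far hn hn' hfar hs he.1 hf.1 (hes ▸ he.2.1) (hfs ▸ hf.2.1)
  have apart' : ∀ e f : Placement S, Placed m n' β' e → e.2.2 = s.other → Placed m n β f →
      f.2.2 = s → ¬ Touch (coord m e.1) (coord m f.1) := by
    intro e f he hes hf hfs
    exact not_touch_of_far hn' hn hfar.symm ho he.1 hf.1 (hes ▸ he.2.1)
      (by rw [hoo, ← hfs]; exact hf.2.1)
  have touch_self : ∀ x : ℤ × ℤ, Touch x x := by
    intro x
    unfold Touch
    omega
  -- Heads are the latest placements, so the suffixes of `w` are the stages of the spliced growth.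
  suffices H : ∀ u v, w = v ++ u → Fresh σ u ∧ Relation.ReflTransGen (Attach 1) σ (build σ u) from
    H w [] rfl
  intro u
  induction u with
  | nil => exact fun _ _ => ⟨⟨by simp, by simp⟩, Relation.ReflTransGen.refl⟩
  | cons e u ih =>
    intro v hv
    obtain ⟨hfresh, hreach⟩ := ih (v ++ [e]) (by simp [hv])
    have hew : e ∈ w := by simp [hv]
    have huw : ∀ f ∈ u, f ∈ w := fun f hf => by simp [hv, hf]
    suffices hstep : build σ u e.1 = none ∧ 1 ≤ (build σ u).glueSum e.1 e.2.1 from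
      ⟨fresh_cons.2 ⟨hfresh, hstep.1⟩,
        hreach.tail (attach_of_glueSum hstep.1 (by exact_mod_cast hstep.2))⟩
    by_cases heo : e.2.2 = s.other
    -- A tile of the transplanted side: it touches no tile of side `s`, and its left neighbours lie
    -- in the strip, where both worlds agree, order included.
    · obtain ⟨a, r, hlr, hru⟩ := exists_suffix_of_filter (P := givesSide m s.other) (e := e)
        (by simp [givesSide, heo]) (hv ▸ hw')
      have hr : Grown σ (Placed m n' β') (e :: r) := (hlr ▸ hl').of_append
      have he : Placed m n' β' e := hr.2.2.1
      have memu : ∀ f, (f.2.2 = s.other ∨ Strip m f.1) → (f ∈ u ↔ f ∈ r) := by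
        intro f hf
        have hf' : givesSide m s.other f = true := by simpa [givesSide] using hf
        have : f ∈ r.filter (givesSide m s.other) ↔ f ∈ u.filter (givesSide m s.other) := by
          rw [hru]
        simpa [List.mem_filter, hf'] using this.symm
      have other : ∀ f ∈ u, Touch (coord m e.1) (coord m f.1) → f.2.2 ≠ s := by
        intro f hf ht hfs
        have hfo : f.2.2 ≠ s.other := by rw [hfs]; cases s <;> simp_all [Side.other]
        exact apart' e f he heo (hl.forall_mem f (memw f (huw f hf) (Or.inl hfo))) hfs ht
      refine glueSum_transfer hr.1.fresh hfresh hr.2.1 hr.2.2.2 ?_ ?_ ?_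
      · intro f hf hfe
        have hfs := other f hf (hfe ▸ touch_self _)
        by_cases hfo : f.2.2 = s.other
        · exact (memu f (Or.inl hfo)).1 hf
        · have hfl : f.2.2 = .left := by
            by_contra hne
            exact hfs (eq_s _ hfo hne)
          have h1 := left (hl.forall_mem f (memw f (huw f hf) (Or.inl hfo))) hfl
          have h2 := right he (heo ▸ ho)
          rw [hfe] at h1
          omega
      · intro f hf d hfe
        have hfs := other f hf (hfe ▸ touch_coord hm e.1 d)
        by_cases hfo : f.2.2 = s.other
        · exact ⟨(memu f (Or.inl hfo)).1 hf, Or.inl (heo.trans hfo.symm)⟩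
        · have hfl : f.2.2 = .left := by
            by_contra hne
            exact hfs (eq_s _ hfo hne)
          have hst := (strip_of_adjacent hm (d := d.opp) (p := f.1) (q := e.1)
            (by rw [hfe, Dir.vec_opp]; simp)
            (left (hl.forall_mem f (memw f (huw f hf) (Or.inl hfo))) hfl)
            (right he (heo ▸ ho)) he.1).1
          exact ⟨(memu f (Or.inr hst)).1 hf, Or.inr (Or.inr hfl)⟩
      · intro f hf d hfe hsee
        rcases hsee with h | h | h
        · exact (memu f (Or.inl (h ▸ heo))).2 hf
        · exact absurd h (heo ▸ ho)
        · have hst := (strip_of_adjacent hm (d := d.opp) (p := f.1) (q := e.1)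
            (by rw [hfe, Dir.vec_opp]; simp) (left (hr.1.forall_mem f hf) h)
            (right he (heo ▸ ho)) he.1).1
          exact (memu f (Or.inr hst)).2 hf
    -- A tile of side `s` or of the left: only a left tile can touch the transplanted side, and then
    -- across the strip.
    · obtain ⟨a, r, hlr, hru⟩ := exists_suffix_of_filter (P := keepsSide m s.other) (e := e)
        (by simp [keepsSide, heo]) (hv ▸ hw)
      have hr : Grown σ (Placed m n β) (e :: r) := (hlr ▸ hl).of_append
      have he : Placed m n β e := hr.2.2.1
      have memu : ∀ f, (f.2.2 ≠ s.other ∨ Strip m f.1) → (f ∈ u ↔ f ∈ r) := by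
        intro f hf
        have hf' : keepsSide m s.other f = true := by simpa [keepsSide] using hf
        have : f ∈ r.filter (keepsSide m s.other) ↔ f ∈ u.filter (keepsSide m s.other) := by
          rw [hru]
        simpa [List.mem_filter, hf'] using this.symm
      have hel : ∀ f ∈ u, f.2.2 = s.other → Touch (coord m e.1) (coord m f.1) →
          e.2.2 = .left := by
        intro f hf hfo ht
        by_contra hne
        exact apart e f he (eq_s _ heo hne)
          (hl'.forall_mem f (memw' f (huw f hf) (Or.inl hfo))) hfo ht
      refine glueSum_transfer hr.1.fresh hfresh hr.2.1 hr.2.2.2 ?_ ?_ ?_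
      · intro f hf hfe
        by_cases hfo : f.2.2 = s.other
        · have h1 := left he (hel f hf hfo (hfe ▸ touch_self _))
          have h2 := right (hl'.forall_mem f (memw' f (huw f hf) (Or.inl hfo))) (hfo ▸ ho)
          rw [hfe] at h2
          omega
        · exact (memu f (Or.inl hfo)).1 hf
      · intro f hf d hfe
        by_cases hfo : f.2.2 = s.other
        · have h1 := hel f hf hfo (hfe ▸ touch_coord hm e.1 d)
          have hfp := hl'.forall_mem f (memw' f (huw f hf) (Or.inl hfo))
          have hst := (strip_of_adjacent hm hfe (left he h1) (right hfp (hfo ▸ ho)) hfp.1).2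
          exact ⟨(memu f (Or.inr hst)).1 hf, Or.inr (Or.inl h1)⟩
        · refine ⟨(memu f (Or.inl hfo)).1 hf, ?_⟩
          by_cases h1 : e.2.2 = .left
          · exact Or.inr (Or.inl h1)
          · rw [eq_s _ heo h1, Side.sees_iff hs]
            exact hfo
      · intro f hf d hfe hsee
        by_cases hfo : f.2.2 = s.other
        · have h1 : e.2.2 = .left := by
            by_contra hne
            rw [eq_s _ heo hne, Side.sees_iff hs] at hsee
            exact hsee hfo
          have hfp := hr.1.forall_mem f hf
          have hst := (strip_of_adjacent hm hfe (left he h1) (right hfp (hfo ▸ ho)) hfp.1).2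
          exact (memu f (Or.inr hst)).2 hf
        · exact (memu f (Or.inl hfo)).2 hf

end FingerFlagpole

/-! ### Impossibility of the simulation -/

/-- Bounds the number of window histories for the pigeonhole argument. -/
theorem finite_nodup_lists {E : Type*} {F : Set E} (hF : F.Finite) :
    {l : List E | l.Nodup ∧ ∀ e ∈ l, e ∈ F}.Finite := by
  classical
  have := hF.to_subtype
  refine ((List.finite_length_le F hF.toFinset.card).image (List.map Subtype.val)).subset ?_
  rintro l ⟨hnd, hl⟩
  refine ⟨l.attach.map fun e => ⟨e.1, hl e.1 e.2⟩, ?_, by simp⟩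
  have h1 : l.toFinset ⊆ hF.toFinset := fun e he => hF.mem_toFinset.2 (hl e (by simpa using he))
  have h2 := Finset.card_le_card h1
  rw [List.toFinset_card_of_nodup hnd] at h2
  simpa using h2

namespace FingerFlagpole

open Assembly Block

variable {S : Finset TileType} {m : ℕ}

/-- The row of the finger tip opposite to the given side. -/
def oppositeRow : Side → ℤ
  | .left => 0
  | .top => -1
  | .bottom => 1

/-- Where a tile can escape from the zone of a side. -/
def Exit (n : ℤ) (s : Side) (q : ℤ × ℤ) : Prop :=
  n ≤ q.1 ∧ (q.2 = 0 ∧ q.1 ≠ n + 1 ∨ q.1 = n + 1 ∧ q.2 = oppositeRow s)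

/-- The zone of a side fills its half of the near region right of the window, so it can be left only
around the keystone: along row 0, or through the keystone block towards the opposite tip. -/
theorem exit_of_touch {n : ℤ} {s : Side} (hs : s ≠ .left) {q x : ℤ × ℤ} (hx : Near n x)
    (hq : 2 ≤ q.1) (hnz : ¬ Zone n s q) (hz : Zone n s x) (h : Touch q x) : Exit n s q := by
  unfold Near at hx
  cases s
  · exact absurd rfl hs
  all_goals
    simp only [Zone, Touch, Exit, oppositeRow] at *
    omega

/-- If one of the fingers is missing, then nothing is represented near the exits of the side of the
other finger. -/
theorem eq_none_of_exit {n : ℕ} {α ω : Assembly tiles} (hα : ∀ p, α p ≠ none → Frame n p)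
    (hkey : α ((n : ℤ) + 1, 0) = some ⟨keystone, by decide⟩)
    (hpole : α ((n : ℤ) + 2, 0) = some ⟨flagpole, by decide⟩)
    (hflag : α ((n : ℤ) + 3, 0) = some ⟨flag, by decide⟩)
    (htop : α ((n : ℤ) + 1, 1) = some ⟨topTip, by decide⟩)
    (hbot : α ((n : ℤ) + 1, -1) = some ⟨bottomTip, by decide⟩)
    (hω : Supported ω) (hsub : ∀ z : ℤ × ℤ, (n : ℤ) - 1 ≤ z.1 → ∀ t, ω z = some t → α z = some t)
    (hn : 10 ≤ n) {s : Side} (hs : s ≠ .left) (hempty : ω ((n : ℤ) + 1, 2 * oppositeRow s) = none)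
    {q y : ℤ × ℤ} (hq : Exit n s q) (hqy : Touch q y) : ω y = none := by
  have tile : ∀ {z : ℤ × ℤ} {t : tiles}, (n : ℤ) - 1 ≤ z.1 → α z = some t → ω z ≠ none →
      ω z = some t := by
    intro z t hz ht hne
    obtain ⟨t', ht'⟩ := Option.ne_none_iff_exists'.1 hne
    have := hsub z hz t' ht'
    rw [ht] at this
    rw [ht', this]
  -- The absence of the finger tile behind the opposite tip propagates along the supports to the
  -- tip, the keystone, the flagpole and the flag.
  have htip : ω ((n : ℤ) + 1, oppositeRow s) = none := by
    by_contra hne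
    cases s with
    | left => exact hs rfl
    | top =>
      have h := (hω _ _ (tile (by simp only; omega) hbot hne)).2.2.2.2 rfl
      simp only [Dir.vec, Prod.mk_add_mk, add_zero] at h
      exact h hempty
    | bottom =>
      have h := (hω _ _ (tile (by simp only; omega) htop hne)).2.2.2.1 rfl
      simp only [Dir.vec, Prod.mk_add_mk, add_zero] at h
      exact h hempty
  have h1 : ω ((n : ℤ) + 1, 0) = none := by
    by_contra hne
    have h := (hω _ _ (tile (by simp only; omega) hkey hne)).1 rfl
    simp only [Dir.vec, Prod.mk_add_mk, add_zero, zero_add] at h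
    cases s with
    | left => exact hs rfl
    | top => exact h.2 htip
    | bottom => exact h.1 htip
  have h2 : ω ((n : ℤ) + 2, 0) = none := by
    by_contra hne
    have h := (hω _ _ (tile (by simp only; omega) hpole hne)).2.1 rfl
    simp only [Dir.vec, Prod.mk_add_mk, add_zero] at h
    rw [show (n : ℤ) + 2 + -1 = n + 1 by ring] at h
    exact h h1
  have h3 : ω ((n : ℤ) + 3, 0) = none := by
    by_contra hne
    have h := (hω _ _ (tile (by simp only; omega) hflag hne)).2.2.1 rfl
    simp only [Dir.vec, Prod.mk_add_mk, add_zero] at h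
    rw [show (n : ℤ) + 3 + -1 = n + 2 by ring] at h
    exact h h2
  by_contra hne
  have hF : Frame n y := by
    obtain ⟨t, ht⟩ := Option.ne_none_iff_exists'.1 hne
    refine hα y ?_
    rw [hsub y ?_ t ht]
    · simp
    · unfold Touch at hqy
      unfold Exit at hq
      omega
  obtain ⟨a, b⟩ := y
  -- Only these five blocks of the frame can be in or next to an exit, and all five are empty.
  have key : (a = n + 1 ∧ b = 0) ∨ (a = n + 2 ∧ b = 0) ∨ (a = n + 3 ∧ b = 0) ∨
      (a = n + 1 ∧ b = oppositeRow s) ∨ (a = n + 1 ∧ b = 2 * oppositeRow s) := by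
    cases s
    · exact absurd rfl hs
    all_goals
      simp only [Exit, Touch, Frame, oppositeRow] at *
      omega
  rcases key with ⟨rfl, rfl⟩ | ⟨rfl, rfl⟩ | ⟨rfl, rfl⟩ | ⟨rfl, rfl⟩ | ⟨rfl, rfl⟩
  · exact hne h1
  · exact hne h2
  · exact hne h3
  · exact hne htip
  · exact hne hempty

theorem filter_keepsSide_givesSide (o : Side) (l : List (Placement S)) :
    (l.filter (keepsSide m o)).filter (givesSide m o) = l.filter fun e => Strip m e.1 := by
  rw [List.filter_filter]
  congr 1
  funext e
  by_cases h : e.2.2 = o <;> simp [keepsSide, givesSide, h]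

theorem filter_givesSide_keepsSide (o : Side) (l : List (Placement S)) :
    (l.filter (givesSide m o)).filter (keepsSide m o) = l.filter fun e => Strip m e.1 := by
  rw [List.filter_filter]
  congr 1
  funext e
  by_cases h : e.2.2 = o <;> simp [keepsSide, givesSide, h]

end FingerFlagpole

namespace RgTAS

open FingerFlagpole Assembly Block

variable {𝒮 : RgTAS} {m : ℕ} {R : Block m 𝒮.tiles → Option system.tiles}

/-- The seed of 𝒮 represents only the tile at the origin, so by clean mapping it stays in or next to
that block. -/
theorem SimulatesUnder.seed_left (h : 𝒮.SimulatesUnder system R) (hR : ValidRepr R)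
    (hm : 0 < m) : ∀ p ∈ 𝒮.seed.dom, (coord m p).1 ≤ 1 := by
  intro p hp
  obtain ⟨hne, hsub⟩ := h.seed_repr hR hm (by decide)
  obtain ⟨u, hu, hmem⟩ := h.clean hR hm (Or.inl Relation.ReflTransGen.refl) hne hp
  have h0 : coord m p + u ∈ FingerFlagpole.seed.dom := hsub.dom_subset hmem
  rw [seed_dom, Set.mem_singleton_iff] at h0
  have := touch_of_sq_le (x := coord m p) hu
  rw [h0] at this
  unfold Touch at this
  simp only at this
  omega

theorem SimulatesUnder.near (h : 𝒮.SimulatesUnder system R) (hR : ValidRepr R) (hm : 0 < m)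
    {n : ℤ} (hn : 0 ≤ n) {β : Assembly 𝒮.tiles} (hβ : 𝒮.FinProducible β)
    (hne : assemblyRepr R β ≠ empty) (hF : ∀ p, assemblyRepr R β p ≠ none → Frame n p) :
    ∀ p ∈ β.dom, Near n (coord m p) := by
  intro p hp
  obtain ⟨u, hu, hmem⟩ := h.clean hR hm hβ.mem hne hp
  exact Frame.near hn (touch_of_sq_le hu) (hF _ hmem)

theorem SimulatesUnder.exists_tile_of_repr (h : 𝒮.SimulatesUnder system R) (hR : ValidRepr R)
    {β : Assembly 𝒮.tiles} {x : ℤ × ℤ} (hx : assemblyRepr R β x ≠ none) :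
    ∃ p ∈ β.dom, coord m p = x := by
  by_contra hcon
  push Not at hcon
  apply hx
  have : ofAssembly m β x = fun _ _ => none := by
    funext i j
    by_contra hne
    exact hcon _ hne (coord_pos x i j)
  unfold assemblyRepr
  rw [this, h.repr_emptyBlock hR]

/-- Two growths for different lengths of the arms, the first of which escapes, that look
the same at the window, contradict the simulation. -/
theorem SimulatesUnder.not_same_window (h : 𝒮.SimulatesUnder system R) (hR : ValidRepr R)
    (hm : 0 < m) {n n' : ℕ} (hn' : 10 ≤ n') (hnn : n' + 10 ≤ n) {α : Assembly FingerFlagpole.tiles}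
    (hα : ∀ p, α p ≠ none → Frame n p)
    (hkey : α ((n : ℤ) + 1, 0) = some ⟨keystone, by decide⟩)
    (hpole : α ((n : ℤ) + 2, 0) = some ⟨flagpole, by decide⟩)
    (hflag : α ((n : ℤ) + 3, 0) = some ⟨flag, by decide⟩)
    (htop : α ((n : ℤ) + 1, 1) = some ⟨topTip, by decide⟩)
    (hbot : α ((n : ℤ) + 1, -1) = some ⟨bottomTip, by decide⟩)
    {β β' : Assembly 𝒮.tiles} (hβα : assemblyRepr R β = α) (hσβ : 𝒮.seed.Sub β)
    {l l' : List (Placement 𝒮.tiles)} (hl : Grown 𝒮.seed (Placed m n β) l)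
    (hl' : Grown 𝒮.seed (Placed m n' β') l') {p : ℤ × ℤ} {t : 𝒮.tiles} {s : Side}
    (hesc : Escapes m n 𝒮.seed β l p t s)
    (hwin : l.filter (fun e => Strip m e.1) = l'.filter fun e => Strip m e.1) : False := by
  obtain ⟨hs, hβp, hnone, hnz, hp2, ⟨e, he, hes, d, hed⟩, hsum⟩ := hesc
  -- The two selections overlap exactly in the strip, where the histories agree by `hwin`.
  obtain ⟨w, hw, hw'⟩ := exists_merge (keepsSide m s.other) (givesSide m s.other)
    (l.filter (keepsSide m s.other)) (l'.filter (givesSide m s.other))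
    (fun e he => (List.mem_filter.1 he).2) (fun e he => (List.mem_filter.1 he).2)
    (by rw [filter_keepsSide_givesSide, filter_givesSide_keepsSide, hwin])
  obtain ⟨hfresh, hreach⟩ := reaches_of_splice hm (by omega) (by omega) (by omega) hs hl hl' hw hw'
  have memw : ∀ f ∈ w, f.2.2 ≠ s.other → f ∈ l := by
    intro f hf hfo
    have : f ∈ l.filter (keepsSide m s.other) := by
      rw [← hw, List.mem_filter]
      exact ⟨hf, by simp [keepsSide, hfo]⟩
    exact List.mem_of_mem_filter this
  have memw' : ∀ f ∈ w, f.2.2 = s.other → (coord m f.1).1 ≤ n' + 4 := by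
    intro f hf hfo
    have : f ∈ l'.filter (givesSide m s.other) := by
      rw [← hw', List.mem_filter]
      exact ⟨hf, by simp [givesSide, hfo]⟩
    exact (hl'.forall_mem f (List.mem_of_mem_filter this)).1.2.2.1
  have meml : ∀ f ∈ l, f.2.2 ≠ s.other → f ∈ w := by
    intro f hf hfo
    have : f ∈ w.filter (keepsSide m s.other) := by
      rw [hw, List.mem_filter]
      exact ⟨hf, by simp [keepsSide, hfo]⟩
    exact List.mem_of_mem_filter this
  have hexit : Exit n s (coord m p) := by
    have hpl := hl.forall_mem e he
    refine exit_of_touch hs hpl.1 hp2 hnz (hes ▸ hpl.2.1) ?_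
    rw [hed]
    exact touch_coord hm p d
  have hpn : (n : ℤ) ≤ (coord m p).1 := hexit.1
  -- The transplanted side ends at block column `n' + 4`, so about the exit the spliced growth
  -- consists of what side `s` sees, and the escaping tile attaches there too.
  obtain ⟨hnone', hsum'⟩ := glueSum_transfer hl.fresh hfresh hnone hsum
    (fun f hf hfp => by
      by_cases hfo : f.2.2 = s.other
      · have := memw' f hf hfo
        rw [hfp] at this
        omega
      · exact memw f hf hfo)
    (fun f hf d hfp => by
      by_cases hfo : f.2.2 = s.other
      · have h1 := memw' f hf hfo
        have h2 := touch_coord hm p d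
        rw [← hfp] at h2
        unfold Touch at h2
        omega
      · exact ⟨memw f hf hfo, (Side.sees_iff hs).2 hfo⟩)
    (fun f hf d hfp hsee => meml f hf ((Side.sees_iff hs).1 hsee))
  have hreach' := hreach.tail (attach_of_glueSum hnone' (by exact_mod_cast hsum'))
  set W := Function.update (build 𝒮.seed w) p (some t) with hW
  have hσW : 𝒮.seed.Sub W := Reaches.sub (Or.inl hreach')
  have hprod : 𝒮.FinProducible W :=
    Relation.ReflTransGen.mono (fun _ _ hab => Or.inl hab) _ _ hreach'
  have hneW : assemblyRepr R W ≠ empty := by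
    intro hemp
    have := assemblyRepr_mono hR hσW
    rw [hemp] at this
    exact (h.seed_repr hR hm (by decide)).1 (eq_empty_of_sub_empty this)
  have hWcases : ∀ q x, W q = some x → (q = p ∧ x = t) ∨ 𝒮.seed q = some x ∨
      ∃ f ∈ w, f.1 = q ∧ f.2.1 = x := by
    intro q x hq
    by_cases hqp : q = p
    · subst hqp
      rw [hW, Function.update_self] at hq
      exact Or.inl ⟨rfl, by simpa using hq.symm⟩
    · rw [hW, Function.update_of_ne hqp] at hq
      exact Or.inr ((build_eq_some_iff hfresh).1 hq)
  -- From column `n - 1` on, all tiles of `W` are tiles of `β`, so only tiles of `α` are represented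
  -- there.
  have hsub : ∀ z : ℤ × ℤ, (n : ℤ) - 1 ≤ z.1 → ∀ t, assemblyRepr R W z = some t →
      α z = some t := by
    intro z hz t' ht'
    rw [← hβα]
    refine assemblyRepr_sub_at hR (fun q x hq hx => ?_) ht'
    rcases hWcases q x hx with ⟨rfl, rfl⟩ | hx | ⟨f, hf, rfl, rfl⟩
    · exact hβp
    · exact hσβ q x hx
    · have hfo : f.2.2 ≠ s.other := by
        intro hfo
        have := memw' f hf hfo
        rw [hq] at this
        omega
      exact (hl.forall_mem f (memw f hf hfo)).2.2
  -- The block behind the opposite tip is in the zone of neither `s` nor the left, and it is not an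
  -- exit; the short world does not reach it.
  have hempty : assemblyRepr R W ((n : ℤ) + 1, 2 * oppositeRow s) = none := by
    by_contra hne
    obtain ⟨q, hq, hqz⟩ := h.exists_tile_of_repr hR hne
    obtain ⟨x, hx⟩ := mem_dom.1 hq
    rcases hWcases q x hx with ⟨rfl, rfl⟩ | hx | ⟨f, hf, rfl, rfl⟩
    · rw [hqz] at hexit
      cases s
      · exact hs rfl
      all_goals
        simp only [Exit, oppositeRow] at hexit
        omega
    · have := h.seed_left hR hm q (mem_dom.2 ⟨x, hx⟩)
      rw [hqz] at this
      simp only at this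
      omega
    · have hfo : f.2.2 ≠ s.other := by
        intro hfo
        have := memw' f hf hfo
        rw [hqz] at this
        simp only at this
        omega
      have hz := (hl.forall_mem f (memw f hf hfo)).2.1
      rw [hqz] at hz
      cases s
      · exact hs rfl
      all_goals
        cases hfs : f.2.2 <;> rw [hfs] at hz hfo <;> simp only [Zone, oppositeRow] at hz <;>
          first | exact hfo rfl | omega
  obtain ⟨u, hu, hmem⟩ := h.clean hR hm hprod.mem hneW (p := p)
    (mem_dom.2 ⟨t, Function.update_self _ _ _⟩)
  exact hmem (eq_none_of_exit hα hkey hpole hflag htop hbot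
    (supported_of_mem_producible (h.repr_mem hprod.mem hneW)) hsub (by omega) hs hempty hexit
    (touch_of_sq_le hu))

theorem not_simulates_fingerFlagpole (𝒮 : RgTAS) : ¬ 𝒮.Simulates system := by
  rintro ⟨m, R, hm, hR, h⟩
  have hτ : 0 < system.temperature := by decide
  -- Steps of 10 in the arm length keep the keystone regions of different worlds apart.
  have hdata : ∀ i : ℕ, ∃ (α : Assembly FingerFlagpole.tiles) (β : Assembly 𝒮.tiles)
      (l : List (Placement 𝒮.tiles)) (p : ℤ × ℤ) (t : 𝒮.tiles) (s : Side),
      ((∀ p, α p ≠ none → Frame (10 * i + 10 : ℕ) p) ∧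
      α (((10 * i + 10 : ℕ) : ℤ) + 1, 0) = some ⟨keystone, by decide⟩ ∧
      α (((10 * i + 10 : ℕ) : ℤ) + 2, 0) = some ⟨flagpole, by decide⟩ ∧
      α (((10 * i + 10 : ℕ) : ℤ) + 3, 0) = some ⟨flag, by decide⟩ ∧
      α (((10 * i + 10 : ℕ) : ℤ) + 1, 1) = some ⟨topTip, by decide⟩ ∧
      α (((10 * i + 10 : ℕ) : ℤ) + 1, -1) = some ⟨bottomTip, by decide⟩) ∧
      assemblyRepr R β = α ∧ 𝒮.seed.Sub β ∧
      Grown 𝒮.seed (Placed m (10 * i + 10 : ℕ) β) l ∧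
      Escapes m (10 * i + 10 : ℕ) 𝒮.seed β l p t s := by
    intro i
    obtain ⟨α, hα, hF, htiles⟩ := exists_flag_assembly (n := 10 * i + 10) (by omega)
    obtain ⟨β, hβ, hβα, hst⟩ := h.exists_stable_repr hR hm hτ hα
      ((Frame.finite (10 * i + 10)).subset fun p hp => hF p hp)
    have hne : assemblyRepr R β ≠ empty := hβα ▸ (h.exists_repr hα).1
    have hseed := h.seed_sub hR hτ hβ hne
    obtain ⟨l, hl, p, t, s, hesc⟩ := exists_escapes hm (n := (10 * i + 10 : ℕ)) (by omega) hseed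
      𝒮.seed_nonempty (h.seed_left hR hm) hst hβ.dom_finite
      (h.near hR hm (by omega) hβ hne (hβα ▸ hF))
      (h.exists_tile_of_repr hR (by rw [hβα, htiles.2.2.1]; exact Option.some_ne_none _))
    exact ⟨α, β, l, p, t, s, ⟨hF, htiles⟩, hβα, hseed, hl, hesc⟩
  choose α β l p t s htiles hβα hseed hl hesc using hdata
  have hfin : {l : List (Placement 𝒮.tiles) | l.Nodup ∧
      ∀ e ∈ l, e ∈ {p : ℤ × ℤ | Strip m p} ×ˢ (Set.univ : Set (𝒮.tiles × Side))}.Finite :=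
    finite_nodup_lists ((strip_finite m).prod Set.finite_univ)
  obtain ⟨i, -, j, -, hij, heq⟩ := Set.infinite_univ.exists_ne_map_eq_of_mapsTo
    (f := fun i : ℕ => (l i).filter fun e => Strip m e.1) (t := _) (by
      intro i _
      refine ⟨(List.Nodup.of_map _ (hl i).fresh.1).filter _, fun e he => ?_⟩
      exact ⟨by simpa using (List.mem_filter.1 he).2, trivial⟩) hfin
  -- The longer world supplies the escaping tile, the shorter one the opposite side.
  have key : ∀ i j : ℕ, i < j →
      (l i).filter (fun e => Strip m e.1) ≠ (l j).filter fun e => Strip m e.1 := by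
    intro i j hij heq
    obtain ⟨hF, h1, h2, h3, h4, h5⟩ := htiles j
    exact h.not_same_window hR hm (n := 10 * j + 10) (n' := 10 * i + 10) (by omega) (by omega)
      hF h1 h2 h3 h4 h5 (hβα j) (hseed j) (hl j) (hl i) (hesc j) heq.symm
  rcases lt_or_gt_of_ne hij with hij | hij
  · exact key i j hij heq
  · exact key j i hij heq.symm

end RgTAS

/-- The finger and flagpole system is a temperature-2 system of the abstract Tile Assembly Model
that no system of the restricted glue Tile Assembly Model simulates. -/
theorem theorem1 :
    FingerFlagpole.system.temperature = 2 ∧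
    ∀ 𝒮 : RgTAS, ¬ 𝒮.Simulates FingerFlagpole.system := by
  exact ⟨rfl, RgTAS.not_simulates_fingerFlagpole⟩
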